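/- **Setting.** Let $W:\mathbb R^d\to\mathbb R$ be a smooth Morse function with $e^{-W/h}\in L^2(\mathbb R^d)$ for small $h>0$, $W(x)\to+\infty$ as $|x|\to\infty$, all derivatives of $W$ bounded by multiples of $(1+|x|^2)^{\eta/2}$ for one $\eta\in\mathbb N$, and finitely many critical points. Let $\mathcal U^{(k)}$ be the set of critical points of index $k$, and assume $\#\mathcal U^{(0)}\ge 2$. Let $a^h>0$ be a function on $\mathbb R^d$ which, with $(a^h)^{-1}$, has all derivatives bounded uniformly in $h$, with a classical expansion $a^h\sim\sum_j h^ja_j$ on $\mathbb R^d$ (each derivative of the remainder after $N$ terms is $O(h^N)$ uniformly) and $a_0=1$ at the critical points of $W$. **Labeling.** Near $x\in\mathcal U^{(1)}$ the set $\{W<W(x)\}$ has two local components; $x$ is a separating saddle point, $x\in\mathcal V^{(1)}$, if these lie in different connected components (CCs) of $\{W<W(x)\}$. Let $\sigma_2>\dots>\sigma_N$ be the values of $W$ on $\mathcal V^{(1)}$ and $\sigma_1=+\infty$. Label the minima injectively as $\mathbf m_{k,j}$, $1\le k\le N$, $j\ge1$, so that $\mathbf m_{k,j}$ is a global minimum of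 $W$ on some CC of $\{W<\sigma_k\}$, and so that for each $k$ the map $T_k$ sending a minimum to its CC of $\{W<\sigma_k\}$ is a bijection from $\mathtt U_k=\{\mathbf m_{k',j}: k'\le k\}\cap\{W<\sigma_k\}$ onto the set of CCs of $\{W<\sigma_k\}$. Let $\underline{\mathbf m}$ be the unique minimum with $k=1$. For another minimum $\mathbf m=\mathbf m_{k,j}$ put $\boldsymbol\sigma(\mathbf m)=\sigma_k$, let $E_-(\mathbf m)$ be the CC of $\{W<\sigma_{k-1}\}$ containing $\mathbf m$, and $\widehat{\mathbf m}=T_{k-1}^{-1}(E_-(\mathbf m))$; $\mathbf m$ is of type I if $W(\widehat{\mathbf m})<W(\mathbf m)$ and of type II if $W(\widehat{\mathbf m})=W(\mathbf m)$. Two minima $\mathbf m,\mathbf m'\ne\underline{\mathbf m}$ are equivalent if $\boldsymbol\sigma(\mathbf m)=\boldsymbol\sigma(\mathbf m')=\sigma_k$ and they are joined by a chain of elements of $\{\mathbf m_{k,j}\}_j\cup\{\widehat{\mathbf m}_{k,j}:\mathbf m_{k,j}\text{ of type II}\}$ such that the closures of the sets $T_k$ of consecutive elements meet. Let $\mathcal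 U_\alpha$ be the equivalence classes, $\widehat{\mathcal U}_\alpha=\mathcal U_\alpha\cup\{\widehat{\mathbf m}\}$ for $\mathbf m\in\mathcal U_\alpha$, $\boldsymbol\sigma(\alpha)=\sigma_{k(\alpha)}$ the common value of $\boldsymbol\sigma$ on $\mathcal U_\alpha$ and, for $\mathbf m\in\widehat{\mathcal U}_\alpha$, $E^\alpha(\mathbf m)=T_{k(\alpha)}(\mathbf m)$ and $\mathbf j^\alpha(\mathbf m)=\partial E^\alpha(\mathbf m)\cap\mathcal V^{(1)}$. **Quasimodes.** Let $r,\varepsilon,\gamma>0$. * Let $\zeta\in C_c^\infty(\mathbb R,[0,1])$ be even, supported in $[-\gamma,\gamma]$, equal to $1$ on $[-\gamma/2,\gamma/2]$, and $A_h=\frac12\int\zeta(s)e^{-s^2/2h}\,ds$. * For $\mathbf m\in\widehat{\mathcal U}_\alpha$, $\mathbf s\in\mathbf j^\alpha(\mathbf m)$ let $\ell^{\mathbf s,\mathbf m}$ be a real smooth function ($h$-dependent) supported in $B(\mathbf s,3r)$, with a classical expansion $\sum_j h^j\ell_j^{\mathbf s,\mathbf m}$ on $B(\mathbf s,2r)$,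 such that $\ell_0^{\mathbf s,\mathbf m}(\mathbf s)=0$ and $\mathbf s$ is a nondegenerate local minimum of $W+(\ell_0^{\mathbf s,\mathbf m})^2/2$. * Let $\theta^\alpha_{\mathbf m,h}(x)=\frac12\big(1+A_h^{-1}\int_0^{\ell^{\mathbf s,\mathbf m}(x)}\zeta(t)e^{-t^2/2h}\,dt\big)$ if $x\in B(\mathbf s,r)$ and $|\ell_0^{\mathbf s,\mathbf m}(x)|\le2\gamma$ for some $\mathbf s\in\mathbf j^\alpha(\mathbf m)$; at all other points, $\theta^\alpha_{\mathbf m,h}=1$ on $E^\alpha(\mathbf m)+B(0,\varepsilon)$ and $\theta^\alpha_{\mathbf m,h}=0$ elsewhere. * Let $\Omega_\alpha$ be the CC of $\{W\le\boldsymbol\sigma(\alpha)\}$ containing $\widehat{\mathcal U}_\alpha$, assume $\min\{W(x): d(x,\Omega_\alpha)=\varepsilon\}=\boldsymbol\sigma(\alpha)+2\tilde\varepsilon_\alpha$ with $\tilde\varepsilon_\alpha>0$, and let $\chi_\alpha\in C_c^\infty(\mathbb R^d,[0,1])$ be supported in $\Omega_\alpha+B(0,\varepsilon)$ and equal to $1$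 on $\{W\le\boldsymbol\sigma(\alpha)+\tilde\varepsilon_\alpha\}\cap(\Omega_\alpha+B(0,\varepsilon))$. The $\ell^{\mathbf s,\mathbf m}$ are such that each $\theta^\alpha_{\mathbf m,h}$ is smooth near $\operatorname{supp}\chi_\alpha$. * Let $c^\alpha_h(\mathbf m)>0$ be such that $(a^h)^{-1}h^{-d/4}c_h^\alpha(\mathbf m)\chi_\alpha\theta^\alpha_{\mathbf m,h}e^{-(W-W(\mathbf m))/h}$ has norm $1$ in $L^2(\mathbb R^d)$, and $c_h(\underline{\mathbf m})>0$ such that $f_{\underline{\mathbf m},h}=(a^h)^{-1}h^{-d/4}c_h(\underline{\mathbf m})e^{-(W-W(\underline{\mathbf m}))/h}$ has norm $1$. * Let $(\varphi^\alpha_{\mathbf m})_{\mathbf m\in\widehat{\mathcal U}_\alpha}$ be an ($h$-dependent) orthonormal family of functions $\widehat{\mathcal U}_\alpha\to\mathbb R$, for the natural inner product, such that: for $\mathbf m\in\mathcal U_\alpha$, $\varphi^\alpha_{\widehat{\mathbf m}}(\tilde{\mathbf m})$ is $0$ if $\tilde{\mathbf m}\in\mathcal U_\alpha$ is of type I and is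 otherwise $\widehat c_h\,c^\alpha_h(\tilde{\mathbf m})^{-1}$ with $\widehat c_h$ independent of $\tilde{\mathbf m}$; $\varphi^\alpha_{\mathbf m}(\tilde{\mathbf m})=\delta_{\mathbf m,\tilde{\mathbf m}}$ if $\mathbf m$ or $\tilde{\mathbf m}$ is a type I element of $\mathcal U_\alpha$; and $\varphi^\alpha_{\mathbf m}(\tilde{\mathbf m})\ne0$ implies $W(\mathbf m)=W(\tilde{\mathbf m})$. * For $\mathbf m\in\mathcal U_\alpha$ put $$f_{\mathbf m,h}=(a^h)^{-1}h^{-d/4}\chi_\alpha\Big(\sum_{\tilde{\mathbf m}\in\widehat{\mathcal U}_\alpha}\varphi^\alpha_{\mathbf m}(\tilde{\mathbf m})\,c^\alpha_h(\tilde{\mathbf m})\,\theta^\alpha_{\tilde{\mathbf m},h}\Big)e^{-(W-W(\mathbf m))/h}.$$ **Statement.** If $r$ and $\varepsilon$ are small enough, then the family $(f_{\mathbf m,h})_{\mathbf m\in\mathcal U^{(0)}}$ is almost orthonormal in $L^2(\mathbb R^d)$: there are $c,C,h_1>0$ such that for all $0<h\le h_1$ and all $\mathbf m,\mathbf m'\in\mathcal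 U^{(0)}$ (of any type) one has $f_{\mathbf m,h},f_{\mathbf m',h}\in L^2(\mathbb R^d)$ and $$\big|\langle f_{\mathbf m,h},f_{\mathbf m',h}\rangle-\delta_{\mathbf m,\mathbf m'}\big|\le C\,e^{-c/h}.$$ -/

import Mathlib

open scoped ContDiff

noncomputable section

namespace Quasimode

/-- The Euclidean space `ℝ^d`. -/
abbrev Space (d : ℕ) := EuclideanSpace ℝ (Fin d)

/-! ### Critical points and Morse index -/

/-- The Hessian of `f` at `x`, as a bilinear form. -/
def hessian {d : ℕ} (f : Space d → ℝ) (x v w : Space d) : ℝ :=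
  fderiv ℝ (fun y => fderiv ℝ f y) x v w

/-- `x` is a critical point of `f`. -/
def IsCritical {d : ℕ} (f : Space d → ℝ) (x : Space d) : Prop :=
  fderiv ℝ f x = 0

/-- The Hessian of `f` at `x` is a nondegenerate bilinear form. -/
def NondegenerateAt {d : ℕ} (f : Space d → ℝ) (x : Space d) : Prop :=
  ∀ v, (∀ w, hessian f x v w = 0) → v = 0

/-- `k` is the index of the Hessian of `f` at `x`: the largest dimension of a subspace on which
it is negative definite. -/
def HasIndex {d : ℕ} (f : Space d → ℝ) (x : Space d) (k : ℕ) : Prop :=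
  IsGreatest {n : ℕ | ∃ V : Submodule ℝ (Space d), Module.finrank ℝ V = n ∧
    ∀ v ∈ V, v ≠ 0 → hessian f x v v < 0} k

/-- The set `𝒰^(k)` of critical points of index `k`. For a Morse function `𝒰^(0)` is the set of
local minima. -/
def critSet {d : ℕ} (W : Space d → ℝ) (k : ℕ) : Set (Space d) :=
  {x | IsCritical W x ∧ HasIndex W x k}

/-- The assumptions on the potential `W`, the semiclassical parameter ranging over `(0, h₀]`. -/
structure IsPotential {d : ℕ} (W : Space d → ℝ) (h₀ : ℝ) : Prop where
  smooth : ContDiff ℝ ∞ W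
  morse : ∀ x, IsCritical W x → NondegenerateAt W x
  square_integrable : ∀ h, 0 < h → h ≤ h₀ →
    MeasureTheory.MemLp (fun x => Real.exp (-W x / h)) 2 MeasureTheory.volume
  confining : Filter.Tendsto W (Filter.cocompact (Space d)) Filter.atTop
  /-- `W` is a symbol: all derivatives are `O(⟨x⟩^η)`, with one `η` for all orders. -/
  symbol : ∃ η : ℕ, ∀ n : ℕ, ∃ C : ℝ, ∀ x,
    ‖iteratedFDeriv ℝ n W x‖ ≤ C * (1 + ‖x‖ ^ 2) ^ ((η : ℝ) / 2)
  finite_crit : ∀ k ≤ d, (critSet W k).Finite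
  two_minima : 2 ≤ (critSet W 0).ncard

/-! ### Sublevel sets, connected components, separating saddle points -/

/-- The set of connected components of `F`. -/
def components {d : ℕ} (F : Set (Space d)) : Set (Set (Space d)) :=
  {C | ∃ x ∈ F, C = connectedComponentIn F x}

/-- The sublevel set `{W < t}`, where `t` may be `+∞`. -/
def below {d : ℕ} (W : Space d → ℝ) (t : EReal) : Set (Space d) :=
  {x | (W x : EReal) < t}

/-- The set `𝒱^(1)` of separating saddle points: the two local components of `{W < W x}` at `x`
lie in different components of `{W < W x}`. -/
def separatingSaddles {d : ℕ} (W : Space d → ℝ) : Set (Space d) :=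
  {x | x ∈ critSet W 1 ∧ ∃ r₀ > 0, ∀ r, 0 < r → r < r₀ →
    ∃ O ∈ nhds x, O ⊆ Metric.ball x r ∧ IsConnected O ∧
      (components (O ∩ {y | W y < W x})).ncard = 2 ∧
      ∀ A ∈ components (O ∩ {y | W y < W x}), ∀ B ∈ components (O ∩ {y | W y < W x}), A ≠ B →
        ∀ C ∈ components {y | W y < W x}, ¬ (A ⊆ C ∧ B ⊆ C)}

/-- The separating saddle values `σ 2 > ⋯ > σ N`, with `σ 1 = +∞`, and a labeling of the minima
of `W` by pairs `(k, j)`, `1 ≤ k ≤ N`, `j ≥ 1`, adapted to these values. -/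
structure Labeling {d : ℕ} (W : Space d → ℝ) where
  N : ℕ
  σ : ℕ → EReal
  σ_one : σ 1 = ⊤
  σ_anti : StrictAntiOn σ (Set.Icc 1 N)
  σ_values : σ '' Set.Icc 2 N = (fun x => (W x : EReal)) '' separatingSaddles W
  label : Space d → ℕ × ℕ
  label_inj : Set.InjOn label (critSet W 0)
  label_mem : ∀ m ∈ critSet W 0, (label m).1 ∈ Set.Icc 1 N ∧ 1 ≤ (label m).2
  /-- Each `m_{k,j}` is a global minimum of `W` on some component of `{W < σ k}`. -/
  adapted_min : ∀ m ∈ critSet W 0, ∃ C ∈ components (below W (σ (label m).1)),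
    m ∈ C ∧ ∀ x ∈ C, W m ≤ W x
  /-- Sending a minimum with first label at most `k` and value below `σ k` to its component of
  `{W < σ k}` is a bijection onto the set of components of `{W < σ k}`. -/
  adapted_bij : ∀ k ∈ Set.Icc 1 N,
    Set.BijOn (fun m => connectedComponentIn (below W (σ k)) m)
      {m | m ∈ critSet W 0 ∧ (label m).1 ≤ k ∧ (W m : EReal) < σ k}
      (components (below W (σ k)))

namespace Labeling

/-- The first label `k` of `m = m_{k,j}`. -/
def rank {d : ℕ} {W : Space d → ℝ} (L : Labeling W) (m : Space d) : ℕ := (L.label m).1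

/-- The set `U_k^(0)` of minima with first label at most `k` and value below `σ k`. -/
def upTo {d : ℕ} {W : Space d → ℝ} (L : Labeling W) (k : ℕ) : Set (Space d) :=
  {m | m ∈ critSet W 0 ∧ L.rank m ≤ k ∧ (W m : EReal) < L.σ k}

/-- `T k m` is the component of `{W < σ k}` containing `m`. -/
def T {d : ℕ} {W : Space d → ℝ} (L : Labeling W) (k : ℕ) (m : Space d) : Set (Space d) :=
  connectedComponentIn (below W (L.σ k)) m

/-- `𝛔(m) = σ k` for `m = m_{k,j}`, the common value of `W` on the saddle points of `m`. -/
def saddleValue {d : ℕ} {W : Space d → ℝ} (L : Labeling W) (m : Space d) : EReal :=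
  L.σ (L.rank m)

/-- The minima other than the one with first label `1` (there is exactly one such minimum). -/
def excited {d : ℕ} {W : Space d → ℝ} (L : Labeling W) : Set (Space d) :=
  {m | m ∈ critSet W 0 ∧ L.rank m ≠ 1}

/-- `hat m = T_{k-1}⁻¹ (E_-(m))` for `m = m_{k,j}` with `k ≥ 2`, where `E_-(m)` is the component
of `{W < σ (k-1)}` containing `m`. -/
def hat {d : ℕ} {W : Space d → ℝ} (L : Labeling W) (m : Space d) : Space d :=
  Function.invFunOn (L.T (L.rank m - 1)) (L.upTo (L.rank m - 1)) (L.T (L.rank m - 1) m)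

/-- Minima of type I. -/
def IsTypeI {d : ℕ} {W : Space d → ℝ} (L : Labeling W) (m : Space d) : Prop :=
  m ∈ L.excited ∧ W (L.hat m) < W m

/-- Minima of type II. -/
def IsTypeII {d : ℕ} {W : Space d → ℝ} (L : Labeling W) (m : Space d) : Prop :=
  m ∈ L.excited ∧ W (L.hat m) = W m

/-- The minima that may occur in a chain at level `k`. -/
def chainSet {d : ℕ} {W : Space d → ℝ} (L : Labeling W) (k : ℕ) : Set (Space d) :=
  {m | m ∈ critSet W 0 ∧ L.rank m = k} ∪
    {n | ∃ m, m ∈ critSet W 0 ∧ L.rank m = k ∧ L.IsTypeII m ∧ n = L.hat m}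

/-- The equivalence relation `ℛ` on the excited minima: equal saddle value `σ k`, and a chain of
minima of `chainSet k` for which the closures of consecutive components `T k` meet. -/
def Rel {d : ℕ} {W : Space d → ℝ} (L : Labeling W) (m m' : Space d) : Prop :=
  m ∈ L.excited ∧ m' ∈ L.excited ∧ L.saddleValue m = L.saddleValue m' ∧
    Relation.ReflTransGen
      (fun a b => a ∈ L.chainSet (L.rank m) ∧ b ∈ L.chainSet (L.rank m) ∧
        (closure (L.T (L.rank m) a) ∩ closure (L.T (L.rank m) b)).Nonempty) m m'

/-- The equivalence class of `m`. -/
def cls {d : ℕ} {W : Space d → ℝ} (L : Labeling W) (m : Space d) : Set (Space d) :=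
  {m' | L.Rel m m'}

/-- The set of equivalence classes `𝒰_α^(0)`; a class plays the role of its own index `α`. -/
def classes {d : ℕ} {W : Space d → ℝ} (L : Labeling W) : Set (Set (Space d)) :=
  L.cls '' L.excited

/-- `k(α)`, the common first label of the elements of `α`. -/
def classRank {d : ℕ} {W : Space d → ℝ} (L : Labeling W) (α : Set (Space d)) : ℕ :=
  sInf (L.rank '' α)

/-- The (finite) saddle value `𝛔(α)` of a class. -/
def classLevel {d : ℕ} {W : Space d → ℝ} (L : Labeling W) (α : Set (Space d)) : ℝ :=
  (L.σ (L.classRank α)).toReal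

/-- The enlarged class `𝒰_α ∪ {hat m}`, where `hat m` is the same for all `m ∈ α`. -/
def hatClass {d : ℕ} {W : Space d → ℝ} (L : Labeling W) (α : Set (Space d)) : Set (Space d) :=
  α ∪ L.hat '' α

/-- `E^α(m)`, the component of `{W < 𝛔(α)}` containing `m`. -/
def well {d : ℕ} {W : Space d → ℝ} (L : Labeling W) (α : Set (Space d)) (m : Space d) :
    Set (Space d) :=
  L.T (L.classRank α) m

/-- `𝐣^α(m)`, the separating saddle points on the boundary of `E^α(m)`. -/
def saddles {d : ℕ} {W : Space d → ℝ} (L : Labeling W) (α : Set (Space d)) (m : Space d) :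
    Set (Space d) :=
  frontier (L.well α m) ∩ separatingSaddles W

end Labeling

/-! ### Classical expansions and the amplitude -/

/-- The family `a h`, `0 < h ≤ h₀`, admits on the open set `D` the classical expansion
`a h ∼ ∑ h ^ j * b j`. The case `n = 0` of the sum says that all derivatives of `a` are bounded. -/
structure HasClassicalExpansion {d : ℕ} (h₀ : ℝ) (a : ℝ → Space d → ℝ) (b : ℕ → Space d → ℝ)
    (D : Set (Space d)) : Prop where
  smooth : ∀ h, 0 < h → h ≤ h₀ → ContDiffOn ℝ ∞ (a h) D
  smooth_coeff : ∀ j, ContDiffOn ℝ ∞ (b j) D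
  bound : ∀ k n : ℕ, ∃ C : ℝ, ∀ h, 0 < h → h ≤ h₀ → ∀ x ∈ D,
    ‖iteratedFDeriv ℝ k (fun y => a h y - ∑ j ∈ Finset.range n, h ^ j * b j y) x‖ ≤ C * h ^ n

/-- The assumptions on the amplitude `a^h`: a positive symbol in `S⁰(1)` with a classical
expansion, whose inverse is in `S⁰(1)`, and with `a_0 = 1` at the critical points of `W`. -/
structure IsAmplitude {d : ℕ} (W : Space d → ℝ) (h₀ : ℝ) (a : ℝ → Space d → ℝ) : Prop where
  expansion : ∃ b : ℕ → Space d → ℝ, HasClassicalExpansion h₀ a b Set.univ ∧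
    ∀ x, IsCritical W x → b 0 x = 1
  pos : ∀ h, 0 < h → h ≤ h₀ → ∀ x, 0 < a h x
  inv_bound : ∀ k : ℕ, ∃ C : ℝ, ∀ h, 0 < h → h ≤ h₀ → ∀ x,
    ‖iteratedFDeriv ℝ k (fun y => (a h y)⁻¹) x‖ ≤ C

/-! ### The gaussian quasimodes -/

/-- The choices that enter the construction of the quasimodes. -/
structure Choices (d : ℕ) where
  /-- radius around the saddle points -/
  r : ℝ
  /-- size of the neighborhoods of the wells -/
  ε : ℝ
  /-- size of the cut-off `ζ` -/
  γ : ℝ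
  ζ : ℝ → ℝ
  /-- `ℓ s m h x` is the function `ℓ^{s,m}` at the parameter `h` and the point `x` -/
  ℓ : Space d → Space d → ℝ → Space d → ℝ
  /-- `ℓcoeff s m j` is the `j`-th term of the classical expansion of `ℓ^{s,m}` -/
  ℓcoeff : Space d → Space d → ℕ → Space d → ℝ
  /-- `Ω α`, a component of `{W ≤ 𝛔(α)}` -/
  Ω : Set (Space d) → Set (Space d)
  /-- the gap `ε̃` for the class `α` -/
  gap : Set (Space d) → ℝ
  /-- the cut-off `χ_α` -/
  χ : Set (Space d) → Space d → ℝ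
  /-- `φ α h m m'` is the coefficient `φ^α_m(m')` at the parameter `h` -/
  φ : Set (Space d) → ℝ → Space d → Space d → ℝ

namespace Choices

/-- The normalization `A_h`. -/
def A {d : ℕ} (D : Choices d) (h : ℝ) : ℝ :=
  (1 / 2) * ∫ s : ℝ, D.ζ s * Real.exp (-s ^ 2 / (2 * h))

open Classical in
/-- The function `θ^α_{m,h}`. (For small `r` at most one saddle point qualifies at each `x`.) -/
def θ {d : ℕ} {W : Space d → ℝ} (D : Choices d) (L : Labeling W) (α : Set (Space d))
    (m : Space d) (h : ℝ) (x : Space d) : ℝ :=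
  if hs : ∃ s, s ∈ L.saddles α m ∧ x ∈ Metric.ball s D.r ∧ |D.ℓcoeff s m 0 x| ≤ 2 * D.γ then
    (1 / 2) * (1 + (D.A h)⁻¹ *
      ∫ t in (0 : ℝ)..(D.ℓ hs.choose m h x), D.ζ t * Real.exp (-t ^ 2 / (2 * h)))
  else if x ∈ Metric.thickening D.ε (L.well α m) then 1
  else 0

/-- The function `(a^h)⁻¹ h^{-d/4} χ_α θ^α_{m,h} e^{-(W - W m)/h}`. -/
def bump {d : ℕ} {W : Space d → ℝ} (D : Choices d) (L : Labeling W) (a : ℝ → Space d → ℝ)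
    (α : Set (Space d)) (m : Space d) (h : ℝ) (x : Space d) : ℝ :=
  (a h x)⁻¹ * h ^ (-(d : ℝ) / 4) * D.χ α x * D.θ L α m h x * Real.exp (-(W x - W m) / h)

/-- The factor `c^α_h(m)` that normalizes `bump` in `L²(ℝ^d)`. -/
def c {d : ℕ} {W : Space d → ℝ} (D : Choices d) (L : Labeling W) (a : ℝ → Space d → ℝ)
    (α : Set (Space d)) (m : Space d) (h : ℝ) : ℝ :=
  (Real.sqrt (∫ x, D.bump L a α m h x ^ 2))⁻¹

end Choices

/-- The requirements on the choices. All `h`-dependent objects are considered for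
`0 < h ≤ h₀`. -/
structure IsAdmissible {d : ℕ} {W : Space d → ℝ} (L : Labeling W) (h₀ : ℝ)
    (a : ℝ → Space d → ℝ) (D : Choices d) : Prop where
  r_pos : 0 < D.r
  ε_pos : 0 < D.ε
  γ_pos : 0 < D.γ
  -- the cut-off `ζ`
  ζ_smooth : ContDiff ℝ ∞ D.ζ
  ζ_mem : ∀ t, D.ζ t ∈ Set.Icc (0 : ℝ) 1
  ζ_even : ∀ t, D.ζ (-t) = D.ζ t
  ζ_support : tsupport D.ζ ⊆ Set.Icc (-D.γ) D.γ
  ζ_one : ∀ t ∈ Set.Icc (-(D.γ / 2)) (D.γ / 2), D.ζ t = 1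
  -- the functions `ℓ^{s,m}`
  ℓ_smooth : ∀ α ∈ L.classes, ∀ m ∈ L.hatClass α, ∀ s ∈ L.saddles α m, ∀ h, 0 < h → h ≤ h₀ →
    ContDiff ℝ ∞ (D.ℓ s m h) ∧ tsupport (D.ℓ s m h) ⊆ Metric.ball s (3 * D.r)
  ℓ_expansion : ∀ α ∈ L.classes, ∀ m ∈ L.hatClass α, ∀ s ∈ L.saddles α m,
    HasClassicalExpansion h₀ (D.ℓ s m) (D.ℓcoeff s m) (Metric.ball s (2 * D.r))
  ℓ_zero : ∀ α ∈ L.classes, ∀ m ∈ L.hatClass α, ∀ s ∈ L.saddles α m, D.ℓcoeff s m 0 s = 0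
  ℓ_min : ∀ α ∈ L.classes, ∀ m ∈ L.hatClass α, ∀ s ∈ L.saddles α m,
    IsLocalMin (fun x => W x + D.ℓcoeff s m 0 x ^ 2 / 2) s ∧
    NondegenerateAt (fun x => W x + D.ℓcoeff s m 0 x ^ 2 / 2) s
  θ_smooth : ∀ α ∈ L.classes, ∀ m ∈ L.hatClass α, ∀ h, 0 < h → h ≤ h₀ →
    ∃ U, IsOpen U ∧ tsupport (D.χ α) ⊆ U ∧ ContDiffOn ℝ ∞ (D.θ L α m h) U
  -- the component `Ω α` of `{W ≤ 𝛔(α)}` containing the enlarged class, and the cut-off `χ_α`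
  Ω_component : ∀ α ∈ L.classes,
    D.Ω α ∈ components {x | W x ≤ L.classLevel α} ∧ L.hatClass α ⊆ D.Ω α
  gap_pos : ∀ α ∈ L.classes, 0 < D.gap α
  gap_eq : ∀ α ∈ L.classes,
    IsLeast (W '' {x | Metric.infDist x (D.Ω α) = D.ε}) (L.classLevel α + 2 * D.gap α)
  χ_smooth : ∀ α ∈ L.classes, ContDiff ℝ ∞ (D.χ α)
  χ_compact : ∀ α ∈ L.classes, HasCompactSupport (D.χ α)
  χ_mem : ∀ α ∈ L.classes, ∀ x, D.χ α x ∈ Set.Icc (0 : ℝ) 1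
  χ_one : ∀ α ∈ L.classes, ∀ x ∈ Metric.thickening D.ε (D.Ω α),
    W x ≤ L.classLevel α + D.gap α → D.χ α x = 1
  χ_support : ∀ α ∈ L.classes, tsupport (D.χ α) ⊆ Metric.thickening D.ε (D.Ω α)
  -- the coefficients `φ^α_m`: an orthonormal family of functions on the enlarged class
  φ_norm : ∀ α ∈ L.classes, ∀ h, 0 < h → h ≤ h₀ → ∀ m ∈ L.hatClass α,
    ∑ᶠ n ∈ L.hatClass α, D.φ α h m n * D.φ α h m n = 1
  φ_orth : ∀ α ∈ L.classes, ∀ h, 0 < h → h ≤ h₀ → ∀ m ∈ L.hatClass α, ∀ m' ∈ L.hatClass α,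
    m ≠ m' → ∑ᶠ n ∈ L.hatClass α, D.φ α h m n * D.φ α h m' n = 0
  φ_hat : ∀ α ∈ L.classes, ∀ h, 0 < h → h ≤ h₀ → ∀ m ∈ α, ∃ C : ℝ, ∀ n ∈ L.hatClass α,
    (n ∈ α → L.IsTypeI n → D.φ α h (L.hat m) n = 0) ∧
    (¬ (n ∈ α ∧ L.IsTypeI n) → D.φ α h (L.hat m) n = C * (D.c L a α n h)⁻¹)
  φ_typeI : ∀ α ∈ L.classes, ∀ h, 0 < h → h ≤ h₀ → ∀ m ∈ L.hatClass α, ∀ n ∈ L.hatClass α,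
    (m ∈ α ∧ L.IsTypeI m) ∨ (n ∈ α ∧ L.IsTypeI n) →
      (m = n → D.φ α h m n = 1) ∧ (m ≠ n → D.φ α h m n = 0)
  φ_ne_zero : ∀ α ∈ L.classes, ∀ h, 0 < h → h ≤ h₀ → ∀ m ∈ L.hatClass α, ∀ n ∈ L.hatClass α,
    D.φ α h m n ≠ 0 → W m = W n

/-- The global quasimode before normalization, `(a^h)⁻¹ h^{-d/4} e^{-(W - W m)/h}`. -/
def groundBump {d : ℕ} (W : Space d → ℝ) (a : ℝ → Space d → ℝ) (m : Space d) (h : ℝ)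
    (x : Space d) : ℝ :=
  (a h x)⁻¹ * h ^ (-(d : ℝ) / 4) * Real.exp (-(W x - W m) / h)

/-- The quasimode `f_{m,h}`: for the minimum with first label `1` it is the normalized function
`groundBump`, for `m` in the class `α` it is
`(a^h)⁻¹ h^{-d/4} χ_α (∑_n φ^α_m(n) c^α_h(n) θ^α_{n,h}) e^{-(W - W m)/h}`. -/
def quasimode {d : ℕ} {W : Space d → ℝ} (L : Labeling W) (a : ℝ → Space d → ℝ) (D : Choices d)
    (m : Space d) (h : ℝ) (x : Space d) : ℝ :=
  if L.rank m = 1 then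
    (Real.sqrt (∫ y, groundBump W a m h y ^ 2))⁻¹ * groundBump W a m h x
  else
    (a h x)⁻¹ * h ^ (-(d : ℝ) / 4) * D.χ (L.cls m) x *
      (∑ᶠ n ∈ L.hatClass (L.cls m),
        D.φ (L.cls m) h m n * D.c L a (L.cls m) n h * D.θ L (L.cls m) n h x) *
      Real.exp (-(W x - W m) / h)

open Classical in
/-- The Kronecker symbol. -/
def kronecker {d : ℕ} (m m' : Space d) : ℝ := if m = m' then 1 else 0

end Quasimode

end

open Quasimode

/-!
The quasimodes are almost orthonormal because everything that spoils orthonormality lives at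
energies where the weight `e^{-(2 W - W m - W m') / h}` is exponentially small, and only crude
exponential bounds are needed. Fix an energy gap `κ` (`IsGap`) at most half of the distances
between distinct levels `σ k`, and between these levels and the minima below them. If `r` and `ε`
are smaller than the length `δ` over which `W` varies by less than `κ`, then `χ_α θ^α_n` is
the indicator function of the well `T k n`, except at energies above `σ k - κ`
(`cutoff_eq_one`, `mem_T_of_cutoff_ne_zero`). As the normalization factors grow subexponentially
(`subExp_inv_sqrt_integral`), three facts remain.

* For minima of the same rank, the product of two quasimodes is a double sum over wells. Distinct
  wells do not interact (`expSmall_integral_bump_mul_bump`). Within one class, the diagonal terms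
  give the Kronecker symbol, as the coefficients `φ` are orthonormal; for different classes they
  vanish (`φ_mul_φ_eq_zero`). The latter is topological: a common well would be that of
  the common hat of two minima of type II in one component `Ω` of `{W ≤ σ k}`. Since `W` is Morse,
  `Ω` is the union of the closures of its wells, and by connectedness these are linked by chains,
  so that the two minima would be equivalent (`Labeling.rel_of_mem_component`).
* For minima `m`, `m'` with `rank m' < rank m`, each cutoff in the quasimode of `m'` is constant,
  equal to `0` or `1`, on the support of the quasimode of `m`, which leaves the pairing of the
  latter with the global function `e^{-(W - W n') / h}`. If `W n' < W m`, it is small because of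
  the weights. Otherwise `m` is of type II and the leading terms add up to a multiple of
  `∑ φ_m(n) / c(n)`, which is zero because `φ_m` is orthogonal to `φ_{hat m}`
  (`expSmall_integral_quasimode_mul_groundBump`).
* The quasimode of the minimum of rank `1` is the global function itself, and is treated alike
  (`expSmall_gram_ground`).
-/

namespace Quasimode

open Set Filter Topology Asymptotics MeasureTheory

variable {d : ℕ} {W : Space d → ℝ} {h₀ : ℝ}

/-! ### Sublevel sets and their components -/

theorem isOpen_below (hW : Continuous W) (t : EReal) : IsOpen (below W t) :=
  isOpen_lt (continuous_coe_real_ereal.comp hW) continuous_const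

theorem below_mono {s t : EReal} (hst : s ≤ t) : below W s ⊆ below W t :=
  fun _ hx => lt_of_lt_of_le hx hst

theorem isOpen_component (hW : Continuous W) (t : EReal) (m : Space d) :
    IsOpen (connectedComponentIn (below W t) m) :=
  (isOpen_below hW t).connectedComponentIn

theorem le_of_mem_closure_component (hW : Continuous W) {t : ℝ} {m x : Space d}
    (hx : x ∈ closure (connectedComponentIn (below W t) m)) : W x ≤ t := by
  have hcl : IsClosed {y | W y ≤ t} := isClosed_le hW continuous_const
  refine closure_minimal (fun y hy => ?_) hcl hx
  have hyt : y ∈ below W t := connectedComponentIn_subset _ _ hy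
  exact (EReal.coe_lt_coe_iff.1 hyt).le

theorem eq_of_mem_frontier_component (hW : Continuous W) {t : ℝ} {m x : Space d}
    (hx : x ∈ frontier (connectedComponentIn (below W t) m)) : W x = t := by
  rw [(isOpen_component hW _ _).frontier_eq] at hx
  refine le_antisymm (le_of_mem_closure_component hW hx.1) (not_lt.1 fun hlt => hx.2 ?_)
  have hxb : x ∈ below W t := EReal.coe_lt_coe_iff.2 hlt
  obtain ⟨y, hy⟩ := closure_nonempty_iff.1 ⟨x, hx.1⟩
  have hpre : IsPreconnected (insert x (connectedComponentIn (below W t) m)) :=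
    isPreconnected_connectedComponentIn.subset_closure (subset_insert _ _)
      (insert_subset hx.1 subset_closure)
  rw [connectedComponentIn_eq hy]
  exact hpre.subset_connectedComponentIn (mem_insert_of_mem _ hy)
    (insert_subset hxb (connectedComponentIn_subset _ _)) (mem_insert _ _)

/-- A segment that leaves a component of `{W < t}` passes through a point where `W = t`. -/
theorem exists_eq_of_dist_lt (hW : Continuous W) {t ε : ℝ} {m x y : Space d}
    (hy : y ∈ connectedComponentIn (below W t) m)
    (hx : x ∉ connectedComponentIn (below W t) m) (hxy : dist x y < ε) :
    ∃ z, W z = t ∧ dist x z < ε := by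
  obtain ⟨z, hz, hzf⟩ : ∃ z ∈ segment ℝ x y, z ∈ frontier (connectedComponentIn (below W t) m) := by
    by_contra! hno
    have hno' : ∀ z ∈ segment ℝ x y, z ∈ closure (connectedComponentIn (below W t) m) →
        z ∈ connectedComponentIn (below W t) m := fun z hz hzc => by
      by_contra h
      exact hno z hz ((isOpen_component hW t m).frontier_eq ▸ ⟨hzc, h⟩)
    obtain ⟨z, -, hz, hzc⟩ := (convex_segment (𝕜 := ℝ) x y).isPreconnected _ _
      (isOpen_component hW t m) isClosed_closure.isOpen_compl
      (fun z hz => or_iff_not_imp_right.2 fun h => hno' z hz (not_not.1 h))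
      ⟨y, right_mem_segment ℝ x y, hy⟩
      ⟨x, left_mem_segment ℝ x y, fun h => hx (hno' x (left_mem_segment ℝ x y) h)⟩
    exact hzc (subset_closure hz)
  refine ⟨z, eq_of_mem_frontier_component hW hzf, lt_of_le_of_lt ?_ hxy⟩
  have := dist_add_dist_of_mem_segment hz
  linarith [dist_nonneg (x := z) (y := y)]

/-- Where a Morse function has a local minimum, it is a strict one. -/
theorem eventually_eq_of_isLocalMin (hW : ContDiff ℝ ∞ W) {x : Space d}
    (hnd : NondegenerateAt W x) (hmin : IsLocalMin W x) :
    ∀ᶠ y in 𝓝 x, W y ≤ W x → y = x := by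
  have hd : DifferentiableAt ℝ (fderiv ℝ W) x :=
    ((hW.fderiv_right (m := 1) (by norm_cast)).differentiable one_ne_zero) x
  have hinj : (fderiv ℝ (fderiv ℝ W) x).toLinearMap.ker = ⊥ := by
    refine LinearMap.ker_eq_bot'.2 fun v hv => hnd v fun w => ?_
    have : fderiv ℝ (fderiv ℝ W) x v = 0 := hv
    simp [hessian, this]
  obtain ⟨K, -, hK⟩ := LinearMap.exists_antilipschitzWith _ hinj
  have hne := hd.hasFDerivAt.eventually_ne (c := 0) ⟨K, hK⟩
  rw [eventually_nhdsWithin_iff] at hne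
  filter_upwards [hne, hmin.eventually_nhds] with y hy hmy hle
  by_contra hyx
  refine hy hyx (IsLocalMin.fderiv_eq_zero ?_)
  filter_upwards [hmy] with z hz
  exact hle.trans hz

/-- In a connected subset of `{W ≤ t}` that reaches below `t`, every point is a limit of points
of `{W < t}`: a point that is not would be a local minimum of the Morse function `W`, hence
isolated in `{W ≤ t}`. -/
theorem mem_closure_below (hW : ContDiff ℝ ∞ W)
    (hM : ∀ x, IsCritical W x → NondegenerateAt W x) {t : ℝ} {S : Set (Space d)}
    (hS : IsPreconnected S) (hSt : ∀ x ∈ S, W x ≤ t) {m : Space d} (hm : m ∈ S) (hmt : W m < t)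
    {x : Space d} (hx : x ∈ S) : x ∈ closure (below W t) := by
  by_contra hcl
  have hnb : ∀ᶠ y in 𝓝 x, t ≤ W y := by
    filter_upwards [isClosed_closure.isOpen_compl.mem_nhds hcl] with y hy
    by_contra hlt
    exact hy (subset_closure (EReal.coe_lt_coe_iff.2 (not_le.1 hlt)))
  have hxt : W x = t := le_antisymm (hSt x hx) hnb.self_of_nhds
  have hmin : IsLocalMin W x := by
    filter_upwards [hnb] with y hy
    rwa [hxt]
  obtain ⟨U, hU, hUo, hxU⟩ := eventually_nhds_iff.1
    (eventually_eq_of_isLocalMin hW (hM x hmin.fderiv_eq_zero) hmin)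
  obtain ⟨y, hyS, hyU, hyx⟩ := hS U {x}ᶜ hUo isOpen_compl_singleton
    (fun y _ => by
      by_cases h : y = x
      · exact Or.inl (h ▸ hxU)
      · exact Or.inr h)
    ⟨x, hx, hxU⟩ ⟨m, hm, fun h => by rw [mem_singleton_iff.1 h] at hmt; exact hmt.ne hxt⟩
  exact hyx (hU y hyU (hxt ▸ hSt y hyS))

theorem isCompact_sublevel (hW : Continuous W)
    (hconf : Tendsto W (cocompact (Space d)) atTop) (t : ℝ) : IsCompact {x | W x ≤ t} := by
  obtain ⟨K, hK, hKs⟩ := mem_cocompact.1 (hconf.eventually (eventually_gt_atTop t))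
  refine hK.of_isClosed_subset (isClosed_le hW continuous_const) fun x hx => ?_
  by_contra h
  exact (not_lt.2 hx : ¬ t < W x) (hKs h)

/-! ### The labeling -/

namespace Labeling

variable (L : Labeling W)

/-- The level `σ k` as a real number; meaningful for `2 ≤ k ≤ N`, where `σ k` is finite. -/
noncomputable def level (k : ℕ) : ℝ := (L.σ k).toReal

variable {L}

theorem coe_level {k : ℕ} (hk : k ∈ Icc 2 L.N) : (L.level k : EReal) = L.σ k := by
  have : L.σ k ∈ L.σ '' Icc 2 L.N := mem_image_of_mem _ hk
  rw [L.σ_values] at this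
  obtain ⟨x, -, hx⟩ := this
  rw [level, ← hx, EReal.toReal_coe]

theorem σ_lt {k l : ℕ} (hl : 1 ≤ l) (hlk : l < k) (hk : k ≤ L.N) : L.σ k < L.σ l :=
  L.σ_anti ⟨hl, hlk.le.trans hk⟩ ⟨hl.trans hlk.le, hk⟩ hlk

theorem σ_le {k l : ℕ} (hl : 1 ≤ l) (hlk : l ≤ k) (hk : k ≤ L.N) : L.σ k ≤ L.σ l := by
  rcases hlk.eq_or_lt with rfl | h
  · exact le_rfl
  · exact (σ_lt hl h hk).le

theorem mem_below_rank {m : Space d} (hm : m ∈ critSet W 0) : m ∈ below W (L.σ (L.rank m)) := by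
  obtain ⟨C, ⟨x, -, rfl⟩, hmC, -⟩ := L.adapted_min m hm
  exact connectedComponentIn_subset _ _ hmC

theorem rank_mem {m : Space d} (hm : m ∈ critSet W 0) : L.rank m ∈ Icc 1 L.N :=
  (L.label_mem m hm).1

theorem mem_upTo_rank {m : Space d} (hm : m ∈ critSet W 0) : m ∈ L.upTo (L.rank m) :=
  ⟨hm, le_rfl, mem_below_rank hm⟩

theorem mem_T {k : ℕ} {m : Space d} (hm : m ∈ L.upTo k) : m ∈ L.T k m :=
  mem_connectedComponentIn hm.2.2

/-- A minimum of rank at most `k` is a global minimum of `W` on its component of `{W < σ k}`. -/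
theorem le_of_mem_T {k : ℕ} (hk : k ≤ L.N) {m x : Space d} (hm : m ∈ L.upTo k)
    (hx : x ∈ L.T k m) : W m ≤ W x := by
  obtain ⟨C, ⟨y, -, rfl⟩, hmC, hmin⟩ := L.adapted_min m hm.1
  refine hmin x ?_
  rw [connectedComponentIn_eq hmC]
  exact connectedComponentIn_mono _ (below_mono (σ_le (rank_mem hm.1).1 hm.2.1 hk)) hx

theorem disjoint_T {k : ℕ} (hk : k ∈ Icc 1 L.N) {m n x : Space d} (hm : m ∈ L.upTo k)
    (hn : n ∈ L.upTo k) (hxm : x ∈ L.T k m) (hxn : x ∈ L.T k n) : m = n :=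
  (L.adapted_bij k hk).injOn hm hn
    ((connectedComponentIn_eq hxm).trans (connectedComponentIn_eq hxn).symm)

theorem T_one {m : Space d} : L.T 1 m = univ := by
  have : below W (L.σ 1) = univ := by
    ext x
    simp [below, L.σ_one]
  rw [T, this]
  exact isPreconnected_univ.connectedComponentIn (mem_univ m)

theorem eq_of_rank_one {m n : Space d} (hm : m ∈ critSet W 0) (hn : n ∈ critSet W 0)
    (hm1 : L.rank m = 1) (hn1 : L.rank n = 1) : m = n := by
  have h1 := rank_mem (L := L) hm
  rw [hm1] at h1
  refine disjoint_T (L := L) h1 (hm1 ▸ mem_upTo_rank hm) (hn1 ▸ mem_upTo_rank hn) (x := m) ?_ ?_ <;>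
    simp [T_one]

theorem two_le_rank {m : Space d} (hm : m ∈ L.excited) : L.rank m ∈ Icc 2 L.N := by
  have h := rank_mem (L := L) hm.1
  have := hm.2
  exact ⟨by have := h.1; omega, h.2⟩

theorem hat_aux {m : Space d} (hm : m ∈ L.excited) :
    ∃ n ∈ L.upTo (L.rank m - 1), L.T (L.rank m - 1) n = L.T (L.rank m - 1) m := by
  have hk := two_le_rank hm
  have hk1 : L.rank m - 1 ∈ Icc 1 L.N := ⟨by have := hk.1; omega, by have := hk.2; omega⟩
  have hmb : m ∈ below W (L.σ (L.rank m - 1)) :=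
    below_mono (σ_le hk1.1 (Nat.sub_le _ _) hk.2) (mem_below_rank hm.1)
  exact (L.adapted_bij _ hk1).surjOn ⟨m, hmb, rfl⟩

theorem hat_mem {m : Space d} (hm : m ∈ L.excited) : L.hat m ∈ L.upTo (L.rank m - 1) :=
  Function.invFunOn_mem (hat_aux hm)

theorem T_hat {m : Space d} (hm : m ∈ L.excited) :
    L.T (L.rank m - 1) (L.hat m) = L.T (L.rank m - 1) m :=
  Function.invFunOn_eq (hat_aux hm)

theorem W_hat_le {m : Space d} (hm : m ∈ L.excited) : W (L.hat m) ≤ W m := by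
  have hk := two_le_rank hm
  have hmb : m ∈ below W (L.σ (L.rank m - 1)) :=
    below_mono (σ_le (by have := hk.1; omega) (Nat.sub_le _ _) hk.2) (mem_below_rank hm.1)
  refine le_of_mem_T (by have := hk.2; omega) (hat_mem hm) ?_
  rw [T_hat hm]
  exact mem_connectedComponentIn hmb

theorem rank_hat_lt {m : Space d} (hm : m ∈ L.excited) : L.rank (L.hat m) < L.rank m := by
  have := (hat_mem hm).2.1
  have := (two_le_rank hm).1
  omega

theorem hat_ne {m : Space d} (hm : m ∈ L.excited) : m ≠ L.hat m :=
  fun h => (rank_hat_lt hm).ne (congrArg L.rank h).symm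

theorem hat_mem_upTo_rank {m : Space d} (hm : m ∈ L.excited) : L.hat m ∈ L.upTo (L.rank m) :=
  ⟨(hat_mem hm).1, (rank_hat_lt hm).le,
    lt_of_le_of_lt (EReal.coe_le_coe_iff.2 (W_hat_le hm)) (mem_below_rank hm.1)⟩

/-! ### Equivalence classes of minima -/

theorem Rel.rank_eq {m n : Space d} (h : L.Rel m n) : L.rank m = L.rank n :=
  L.σ_anti.injOn (rank_mem h.1.1) (rank_mem h.2.1.1) h.2.2.1

theorem Rel.refl {m : Space d} (hm : m ∈ L.excited) : L.Rel m m :=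
  ⟨hm, hm, rfl, .refl⟩

theorem Rel.symm {m n : Space d} (h : L.Rel m n) : L.Rel n m := by
  refine ⟨h.2.1, h.1, h.2.2.1.symm, ?_⟩
  rw [← h.rank_eq]
  have : Std.Symm (fun a b => a ∈ L.chainSet (L.rank m) ∧ b ∈ L.chainSet (L.rank m) ∧
      (closure (L.T (L.rank m) a) ∩ closure (L.T (L.rank m) b)).Nonempty) :=
    ⟨fun a b hab => ⟨hab.2.1, hab.1, by rw [inter_comm]; exact hab.2.2⟩⟩
  exact Relation.ReflTransGen.stdSymm.symm _ _ h.2.2.2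

theorem Rel.trans {m n p : Space d} (h : L.Rel m n) (h' : L.Rel n p) : L.Rel m p := by
  refine ⟨h.1, h'.2.1, h.2.2.1.trans h'.2.2.1, h.2.2.2.trans ?_⟩
  rw [h.rank_eq]
  exact h'.2.2.2

theorem cls_eq {m n : Space d} (h : L.Rel m n) : L.cls m = L.cls n :=
  Set.ext fun _ => ⟨fun h' => h.symm.trans h', fun h' => h.trans h'⟩

theorem mem_cls {m : Space d} (hm : m ∈ L.excited) : m ∈ L.cls m := Rel.refl hm

theorem cls_mem_classes {m : Space d} (hm : m ∈ L.excited) : L.cls m ∈ L.classes :=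
  mem_image_of_mem _ hm

theorem classRank_cls {m : Space d} (hm : m ∈ L.excited) : L.classRank (L.cls m) = L.rank m := by
  have : L.rank '' L.cls m = {L.rank m} := by
    ext k
    constructor
    · rintro ⟨n, hn, rfl⟩
      exact (Rel.rank_eq hn).symm
    · rintro rfl
      exact ⟨m, mem_cls hm, rfl⟩
  rw [classRank, this, csInf_singleton]

theorem classLevel_cls {m : Space d} (hm : m ∈ L.excited) :
    L.classLevel (L.cls m) = L.level (L.rank m) := by
  rw [classLevel, classRank_cls hm, level]

theorem well_cls {m : Space d} (hm : m ∈ L.excited) (n : Space d) :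
    L.well (L.cls m) n = L.T (L.rank m) n := by
  rw [well, classRank_cls hm]

theorem hatClass_subset (m : Space d) :
    L.hatClass (L.cls m) ⊆ L.upTo (L.rank m) := by
  rintro n (hn | ⟨p, hp, rfl⟩)
  · rw [Rel.rank_eq hn]
    exact mem_upTo_rank hn.2.1.1
  · rw [Rel.rank_eq hp]
    exact hat_mem_upTo_rank hp.2.1

theorem mem_hatClass {m : Space d} (hm : m ∈ L.excited) : m ∈ L.hatClass (L.cls m) :=
  Or.inl (mem_cls hm)

theorem hat_mem_hatClass {m : Space d} (hm : m ∈ L.excited) :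
    L.hat m ∈ L.hatClass (L.cls m) :=
  Or.inr ⟨m, mem_cls hm, rfl⟩

theorem hatClass_finite (hfin : (critSet W 0).Finite) (m : Space d) :
    (L.hatClass (L.cls m)).Finite :=
  hfin.subset fun _ hn => (hatClass_subset m hn).1

/-- For `l < k`, a connected subset of `{W ≤ σ k}` that meets a component of `{W < σ l}` is
contained in it. -/
theorem subset_T {k l : ℕ} (hk : k ∈ Icc 2 L.N) (hl : 1 ≤ l) (hlk : l < k) {S : Set (Space d)}
    (hS : IsPreconnected S) (hSk : ∀ x ∈ S, W x ≤ L.level k) {n x : Space d}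
    (hxS : x ∈ S) (hx : x ∈ L.T l n) : S ⊆ L.T l n := by
  rw [T, connectedComponentIn_eq hx]
  refine hS.subset_connectedComponentIn hxS fun y hy => lt_of_le_of_lt ?_ (σ_lt hl hlk hk.2)
  rw [← coe_level hk]
  exact EReal.coe_le_coe_iff.2 (hSk y hy)

/-- Minima of the same rank `k` in a common connected subset of `{W ≤ σ k}` have the same hat. -/
theorem hat_eq {m n : Space d} (hm : m ∈ L.excited)
    (hr : L.rank m = L.rank n) {S : Set (Space d)} (hS : IsPreconnected S)
    (hSk : ∀ x ∈ S, W x ≤ L.level (L.rank m)) (hmS : m ∈ S) (hnS : n ∈ S) :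
    L.hat m = L.hat n := by
  have hk := two_le_rank hm
  have hmb : m ∈ below W (L.σ (L.rank m - 1)) :=
    below_mono (σ_le (by have := hk.1; omega) (Nat.sub_le _ _) hk.2) (mem_below_rank hm.1)
  have h := subset_T hk (l := L.rank m - 1) (by have := hk.1; omega) (by have := hk.1; omega)
    hS hSk hmS (mem_connectedComponentIn hmb)
  have : L.T (L.rank m - 1) m = L.T (L.rank m - 1) n := connectedComponentIn_eq (h hnS)
  rw [hat, hat, ← hr, this]

/-- Suppose that `m` is of type II, so that its hat may occur in chains. A component `Ω` of
`{W ≤ σ k}` is the union of the closures of the components of `{W < σ k}` that it contains, and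
since `Ω` is connected, any two of these are linked by a chain. Hence all minima of rank `k` in
the component `Ω` of `m` are equivalent to `m`. -/
theorem rel_of_mem_component (hW : IsPotential W h₀) {m n : Space d} (hm : L.IsTypeII m)
    (hn : n ∈ L.excited) (hr : L.rank m = L.rank n) {Ω : Set (Space d)}
    (hΩ : Ω ∈ components {x | W x ≤ L.level (L.rank m)}) (hmΩ : m ∈ Ω) (hnΩ : n ∈ Ω) :
    L.Rel m n := by
  have hk := two_le_rank hm.1
  have hk1 : L.rank m ∈ Icc 1 L.N := ⟨by have := hk.1; omega, hk.2⟩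
  have hWc := hW.smooth.continuous
  have hfin : (critSet W 0).Finite := hW.finite_crit 0 (Nat.zero_le _)
  obtain ⟨x₀, hx₀, rfl⟩ := hΩ
  set k := L.rank m with hkdef
  set Ω := connectedComponentIn {x | W x ≤ L.level k} x₀ with hΩdef
  have hΩpre : IsPreconnected Ω := isPreconnected_connectedComponentIn
  have hΩle : ∀ x ∈ Ω, W x ≤ L.level k := fun x hx => by
    have : x ∈ {x | W x ≤ L.level k} := connectedComponentIn_subset _ _ hx
    exact this
  have hmk : m ∈ L.upTo k := mem_upTo_rank hm.1.1
  have hnk : n ∈ L.upTo k := by rw [hr]; exact mem_upTo_rank hn.1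
  have hWm : W m < L.level k := by
    have := hmk.2.2
    rwa [← coe_level hk, EReal.coe_lt_coe_iff] at this
  have hTeq : ∀ b, L.T k b = connectedComponentIn (below W (L.level k)) b := fun b => by
    rw [T, coe_level hk]
  -- the closure of a component of `{W < σ k}` that meets `Ω` is contained in `Ω`
  have hsub : ∀ b x, x ∈ closure (L.T k b) → x ∈ Ω → closure (L.T k b) ⊆ Ω := by
    intro b x hxb hxΩ
    rw [hΩdef, connectedComponentIn_eq hxΩ]
    refine (isPreconnected_connectedComponentIn.closure).subset_connectedComponentIn hxb ?_
    intro y (hy : y ∈ closure (L.T k b))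
    rw [hTeq] at hy
    exact le_of_mem_closure_component hWc hy
  have hcover : ∀ x ∈ Ω, ∃ b ∈ L.upTo k, b ∈ Ω ∧ x ∈ closure (L.T k b) := by
    intro x hx
    have hxcl := mem_closure_below hW.smooth hW.morse hΩpre hΩle hmΩ hWm hx
    have hun : below W (L.level k) ⊆ ⋃ b ∈ L.upTo k, L.T k b := by
      intro y hy
      rw [coe_level hk] at hy
      obtain ⟨b, hb, hbe⟩ := (L.adapted_bij k hk1).surjOn ⟨y, hy, rfl⟩
      refine mem_biUnion hb ?_
      have : L.T k b = connectedComponentIn (below W (L.σ k)) y := hbe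
      rw [this]
      exact mem_connectedComponentIn hy
    have hupfin : (L.upTo k).Finite := hfin.subset fun _ h => h.1
    have hx' := closure_mono hun hxcl
    rw [hupfin.closure_biUnion] at hx'
    obtain ⟨b, hb, hxb⟩ := mem_iUnion₂.1 hx'
    exact ⟨b, hb, hsub b x hxb hx (subset_closure (mem_T hb)), hxb⟩
  have hchain : ∀ b ∈ L.upTo k, b ∈ Ω → b ∈ L.chainSet k := by
    intro b hb hbΩ
    rcases hb.2.1.eq_or_lt with h | h
    · exact Or.inl ⟨hb.1, h⟩
    · refine Or.inr ⟨m, hm.1.1, rfl, hm, ?_⟩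
      have hk2 := hk.1
      have hk3 := hk.2
      have hk' : k - 1 ∈ Icc 1 L.N := ⟨by omega, by omega⟩
      have hσ : L.σ k ≤ L.σ (k - 1) := σ_le hk'.1 (Nat.sub_le _ _) hk.2
      have hmb : m ∈ L.T (k - 1) m := mem_connectedComponentIn (below_mono hσ hmk.2.2)
      have hbT := subset_T hk hk'.1 (by omega) hΩpre hΩle hmΩ hmb hbΩ
      have hbu : b ∈ L.upTo (k - 1) := ⟨hb.1, by omega, lt_of_lt_of_le hb.2.2 hσ⟩
      refine disjoint_T hk' hbu (hat_mem hm.1) (mem_T hbu) ?_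
      rw [T_hat hm.1]
      exact hbT
  refine ⟨hm.1, hn, congrArg L.σ hr, ?_⟩
  rw [← hkdef]
  set R : Space d → Space d → Prop := fun a b => a ∈ L.chainSet k ∧ b ∈ L.chainSet k ∧
    (closure (L.T k a) ∩ closure (L.T k b)).Nonempty with hR
  by_contra hnot
  have hfinA : {b | b ∈ L.upTo k ∧ b ∈ Ω ∧ Relation.ReflTransGen R m b}.Finite :=
    hfin.subset fun _ h => h.1.1
  have hfinB : {b | b ∈ L.upTo k ∧ b ∈ Ω ∧ ¬ Relation.ReflTransGen R m b}.Finite :=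
    hfin.subset fun _ h => h.1.1
  -- if no chain led to `n`, the wells reached from `m` and the other ones would give two closed
  -- sets covering `Ω`, and a common point would extend a chain
  obtain ⟨x, -, hxA, hxB⟩ := isPreconnected_closed_iff.1 hΩpre _ _
    (hfinA.isClosed_biUnion fun b _ => isClosed_closure (s := L.T k b))
    (hfinB.isClosed_biUnion fun b _ => isClosed_closure (s := L.T k b))
    (fun x hx => by
      obtain ⟨b, hb, hbΩ, hxb⟩ := hcover x hx
      by_cases h : Relation.ReflTransGen R m b
      · exact Or.inl (mem_biUnion (show b ∈ {b | _} from ⟨hb, hbΩ, h⟩) hxb)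
      · exact Or.inr (mem_biUnion (show b ∈ {b | _} from ⟨hb, hbΩ, h⟩) hxb))
    ⟨m, hmΩ, mem_biUnion (show m ∈ {b | _} from ⟨hmk, hmΩ, .refl⟩) (subset_closure (mem_T hmk))⟩
    ⟨n, hnΩ, mem_biUnion (show n ∈ {b | _} from ⟨hnk, hnΩ, hnot⟩) (subset_closure (mem_T hnk))⟩
  obtain ⟨b, ⟨hb, hbΩ, hbR⟩, hxb⟩ := mem_iUnion₂.1 hxA
  obtain ⟨c, ⟨hc, hcΩ, hcR⟩, hxc⟩ := mem_iUnion₂.1 hxB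
  exact hcR (hbR.tail ⟨hchain b hb hbΩ, hchain c hc hcΩ, x, hxb, hxc⟩)

end Labeling

/-! ### A common energy gap -/

/-- Energy gap `κ` and length `δ`: minima below a level `σ k`, and distinct levels, are separated
by at least `2 κ`, and `W` varies by less than `κ` over the distance `δ` from `{W ≤ σ k}`. -/
structure IsGap (L : Labeling W) (κ δ : ℝ) : Prop where
  κ_pos : 0 < κ
  δ_pos : 0 < δ
  minima : ∀ k ∈ Icc 2 L.N, ∀ n ∈ L.upTo k, W n + 2 * κ ≤ L.level k
  levels : ∀ k ∈ Icc 2 L.N, ∀ l ∈ Icc 2 L.N, l < k → L.level k + 2 * κ ≤ L.level l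
  osc : ∀ k ∈ Icc 2 L.N, ∀ x y, W y ≤ L.level k → dist x y < δ → |W x - W y| < κ

theorem eventually_add_two_mul_le {s t : ℝ} (hst : s < t) : ∀ᶠ κ in 𝓝[>] (0 : ℝ), s + 2 * κ ≤ t := by
  have : Tendsto (fun κ : ℝ => s + 2 * κ) (𝓝[>] 0) (𝓝 (s + 2 * 0)) := by
    refine Tendsto.mono_left (Continuous.tendsto (by fun_prop) _) nhdsWithin_le_nhds
  rw [mul_zero, add_zero] at this
  exact (this.eventually (eventually_lt_nhds hst)).mono fun _ h => h.le

theorem exists_isGap (hW : IsPotential W h₀) (L : Labeling W) : ∃ κ δ, IsGap L κ δ := by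
  have hfin : (critSet W 0).Finite := hW.finite_crit 0 (Nat.zero_le _)
  have hWc := hW.smooth.continuous
  have h1 : ∀ᶠ κ in 𝓝[>] (0 : ℝ), ∀ k ∈ Icc 2 L.N, ∀ n ∈ L.upTo k,
      W n + 2 * κ ≤ L.level k := by
    refine (eventually_all_finite (finite_Icc _ _)).2 fun k hk => ?_
    refine (eventually_all_finite (hfin.subset fun _ h => h.1)).2 fun n hn => ?_
    have := hn.2.2
    rw [← L.coe_level hk, EReal.coe_lt_coe_iff] at this
    exact eventually_add_two_mul_le this
  have h2 : ∀ᶠ κ in 𝓝[>] (0 : ℝ), ∀ k ∈ Icc 2 L.N, ∀ l ∈ Icc 2 L.N, l < k →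
      L.level k + 2 * κ ≤ L.level l := by
    refine (eventually_all_finite (finite_Icc _ _)).2 fun k hk => ?_
    refine (eventually_all_finite (finite_Icc _ _)).2 fun l hl => ?_
    by_cases hlk : l < k
    · have := L.σ_lt (by have := hl.1; omega) hlk hk.2
      rw [← L.coe_level hk, ← L.coe_level hl, EReal.coe_lt_coe_iff] at this
      exact (eventually_add_two_mul_le this).mono fun _ h _ => h
    · exact Eventually.of_forall fun _ h => absurd h hlk
  obtain ⟨κ, ⟨h1, h2⟩, hκ⟩ := ((h1.and h2).and self_mem_nhdsWithin).exists
  obtain ⟨M, hM⟩ := ((finite_Icc 2 L.N).image L.level).bddAbove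
  have hu := (isCompact_sublevel hWc hW.confining M).uniformContinuousAt_of_continuousAt W
    (fun x _ => hWc.continuousAt) (Metric.dist_mem_uniformity hκ)
  obtain ⟨δ, hδ, hu⟩ := Metric.mem_uniformity_dist.1 hu
  refine ⟨κ, δ, hκ, hδ, h1, h2, fun k hk x y hy hxy => ?_⟩
  have := hu (a := y) (b := x) (by rwa [dist_comm]) (hy.trans (hM (mem_image_of_mem _ hk)))
  rw [abs_sub_comm, ← Real.dist_eq]
  exact this

namespace IsGap

variable {L : Labeling W} {κ δ : ℝ}

/-- Points close to a component of `{W < σ k}` but outside of it are at energy near `σ k`. -/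
theorem lt_of_notMem_T (hG : IsGap L κ δ) (hW : Continuous W) {k : ℕ} (hk : k ∈ Icc 2 L.N)
    {n x y : Space d} (hy : y ∈ L.T k n) (hx : x ∉ L.T k n) (hxy : dist x y < δ) :
    L.level k - κ < W x := by
  rw [Labeling.T, ← L.coe_level hk] at hy hx
  obtain ⟨z, hz, hxz⟩ := exists_eq_of_dist_lt hW hy hx hxy
  have := abs_lt.1 (hG.osc k hk x z hz.le hxz)
  linarith [this.1]

end IsGap

/-! ### Exponentially small and subexponential functions of `h` -/

/-- `F h` is exponentially small as `h → 0+`: it is `O(e^{-c/h})` for some `c > 0`. -/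
def ExpSmall (F : ℝ → ℝ) : Prop :=
  ∃ c > 0, F =O[𝓝[>] 0] fun h => Real.exp (-c / h)

/-- `F h` grows subexponentially as `h → 0+`: it is `O(e^{κ/h})` for every `κ > 0`. -/
def SubExp (F : ℝ → ℝ) : Prop :=
  ∀ κ > 0, F =O[𝓝[>] 0] fun h => Real.exp (κ / h)

theorem exp_div_isBigO {s t : ℝ} (hst : s ≤ t) :
    (fun h : ℝ => Real.exp (s / h)) =O[𝓝[>] 0] fun h => Real.exp (t / h) := by
  refine IsBigO.of_bound 1 ?_
  filter_upwards [self_mem_nhdsWithin] with h (hh : 0 < h)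
  rw [one_mul, Real.norm_of_nonneg (Real.exp_pos _).le, Real.norm_of_nonneg (Real.exp_pos _).le]
  gcongr

theorem ExpSmall.congr {F G : ℝ → ℝ} (hF : ExpSmall F) (h : F =ᶠ[𝓝[>] 0] G) : ExpSmall G := by
  obtain ⟨c, hc, hO⟩ := hF
  exact ⟨c, hc, hO.congr' h .rfl⟩

theorem ExpSmall.zero : ExpSmall fun _ => 0 :=
  ⟨1, one_pos, isBigO_zero _ _⟩

theorem ExpSmall.add {F G : ℝ → ℝ} (hF : ExpSmall F) (hG : ExpSmall G) :
    ExpSmall fun h => F h + G h := by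
  obtain ⟨c, hc, hF⟩ := hF
  obtain ⟨c', hc', hG⟩ := hG
  exact ⟨min c c', lt_min hc hc',
    (hF.trans (exp_div_isBigO (neg_le_neg (min_le_left _ _)))).add
      (hG.trans (exp_div_isBigO (neg_le_neg (min_le_right _ _))))⟩

theorem ExpSmall.sum {ι : Type*} {s : Finset ι} {F : ι → ℝ → ℝ} (hF : ∀ i ∈ s, ExpSmall (F i)) :
    ExpSmall fun h => ∑ i ∈ s, F i h := by
  classical
  induction s using Finset.induction_on with
  | empty => simpa using ExpSmall.zero
  | insert i s hi ih =>
    simp only [Finset.sum_insert hi]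
    exact (hF i (Finset.mem_insert_self _ _)).add
      (ih fun j hj => hF j (Finset.mem_insert_of_mem hj))

theorem SubExp.mul {F G : ℝ → ℝ} (hF : SubExp F) (hG : SubExp G) :
    SubExp fun h => F h * G h := by
  intro κ hκ
  refine ((hF (κ / 2) (half_pos hκ)).mul (hG (κ / 2) (half_pos hκ))).congr_right fun h => ?_
  rw [← Real.exp_add]
  congr 1
  ring

theorem ExpSmall.subExp_mul {F G : ℝ → ℝ} (hG : ExpSmall G) (hF : SubExp F) :
    ExpSmall fun h => F h * G h := by
  obtain ⟨c, hc, hG⟩ := hG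
  refine ⟨c / 2, half_pos hc, ((hF (c / 2) (half_pos hc)).mul hG).congr_right fun h => ?_⟩
  rw [← Real.exp_add]
  congr 1
  ring

theorem SubExp.of_bounded {F : ℝ → ℝ} {C : ℝ} (hF : ∀ᶠ h in 𝓝[>] 0, |F h| ≤ C) : SubExp F := by
  intro κ hκ
  have h1 : F =O[𝓝[>] 0] fun h => Real.exp (0 / h) :=
    IsBigO.of_bound C (by simpa using hF)
  exact h1.trans (exp_div_isBigO hκ.le)

theorem SubExp.rpow (s : ℝ) : SubExp fun h => h ^ s := by
  intro κ hκ
  have h1 := (isLittleO_rpow_exp_pos_mul_atTop (-s) hκ).isBigO.comp_tendsto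
    (tendsto_inv_nhdsGT_zero (𝕜 := ℝ))
  refine h1.congr' ?_ ?_
  · filter_upwards [self_mem_nhdsWithin] with h (hh : 0 < h)
    simp [Real.inv_rpow hh.le, Real.rpow_neg hh.le]
  · exact Eventually.of_forall fun h => by simp [div_eq_mul_inv]

theorem expSmall_of_le {F : ℝ → ℝ} {M : ℝ → ℝ} (hM : SubExp M) {c : ℝ} (hc : 0 < c)
    (hF : ∀ᶠ h in 𝓝[>] 0, |F h| ≤ M h * Real.exp (-c / h)) : ExpSmall F := by
  have h1 : ExpSmall fun h => M h * Real.exp (-c / h) :=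
    ExpSmall.subExp_mul ⟨c, hc, isBigO_refl _ _⟩ hM
  obtain ⟨c', hc', h1⟩ := h1
  refine ⟨c', hc', IsBigO.trans (IsBigO.of_bound 1 ?_) h1⟩
  filter_upwards [hF] with h hh
  rw [one_mul]
  exact hh.trans (le_abs_self _)

/-- The uniform constants behind finitely many exponentially small functions. -/
theorem exists_uniform_bound {ι : Type*} {s : Set ι} (hs : s.Finite) {F : ι → ℝ → ℝ}
    (hF : ∀ i ∈ s, ExpSmall (F i)) :
    ∃ c > 0, ∃ C : ℝ, ∀ᶠ h in 𝓝[>] 0, ∀ i ∈ s, |F i h| ≤ C * Real.exp (-c / h) := by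
  have h1 : ExpSmall fun h => ∑ i ∈ hs.toFinset, |F i h| := by
    refine ExpSmall.sum fun i hi => ?_
    obtain ⟨c, hc, hO⟩ := hF i (hs.mem_toFinset.1 hi)
    exact ⟨c, hc, hO.abs_left⟩
  obtain ⟨c, hc, hO⟩ := h1
  obtain ⟨C, hC⟩ := hO.bound
  refine ⟨c, hc, C, ?_⟩
  filter_upwards [hC] with h hh i hi
  rw [Real.norm_of_nonneg (Real.exp_pos _).le] at hh
  refine le_trans ?_ ((le_abs_self _).trans hh)
  exact Finset.single_le_sum (f := fun i => |F i h|) (fun j _ => abs_nonneg _)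
    (hs.mem_toFinset.2 hi)

theorem expSmall_integral {F : ℝ → Space d → ℝ} {K : Set (Space d)} (hK : volume K < ⊤)
    {M : ℝ → ℝ} (hM : SubExp M) {c : ℝ} (hc : 0 < c)
    (hF : ∀ᶠ h in 𝓝[>] 0, ∀ x, |F h x| ≤ M h * Real.exp (-c / h))
    (hFK : ∀ᶠ h in 𝓝[>] 0, ∀ x ∉ K, F h x = 0) : ExpSmall fun h => ∫ x, F h x := by
  refine expSmall_of_le
    (hM.mul (SubExp.of_bounded (F := fun _ => volume.real K) (.of_forall fun _ => le_rfl))) hc ?_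
  filter_upwards [hF, hFK] with h h1 h2
  rw [← setIntegral_eq_integral_of_forall_compl_eq_zero h2]
  refine (norm_setIntegral_le_of_norm_le_const (f := F h) hK fun x _ => h1 x).trans (le_of_eq ?_)
  ring

/-- If a family of functions is at least `e^{-κ/h}`, for any `κ > 0`, on some ball around a fixed
point, then its `L²` normalization factor grows subexponentially. -/
theorem subExp_inv_sqrt_integral {F : ℝ → Space d → ℝ} {n : Space d}
    (hint : ∀ᶠ h in 𝓝[>] 0, Integrable fun x => F h x ^ 2)
    (hF : ∀ κ > 0, ∃ ρ > 0, ∃ b > 0, ∀ᶠ h in 𝓝[>] 0, ∀ x ∈ Metric.ball n ρ,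
      b * Real.exp (-κ / h) ≤ F h x) :
    SubExp (fun h => (Real.sqrt (∫ x, F h x ^ 2))⁻¹) ∧ ∀ᶠ h in 𝓝[>] 0, 0 < ∫ x, F h x ^ 2 := by
  have key : ∀ κ > 0, ∃ b > 0, ∀ᶠ h in 𝓝[>] 0, (b * Real.exp (-κ / h)) ^ 2 ≤ ∫ x, F h x ^ 2 := by
    intro κ hκ
    obtain ⟨ρ, hρ, b, hb, hev⟩ := hF κ hκ
    have hfin : volume (Metric.ball n ρ) < ⊤ := measure_ball_lt_top
    have hv : 0 < volume.real (Metric.ball n ρ) :=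
      ENNReal.toReal_pos (Metric.measure_ball_pos _ _ hρ).ne' hfin.ne
    refine ⟨b * Real.sqrt (volume.real (Metric.ball n ρ)), by positivity, ?_⟩
    filter_upwards [hev, hint] with h h1 h2
    calc (b * Real.sqrt (volume.real (Metric.ball n ρ)) * Real.exp (-κ / h)) ^ 2
        = volume.real (Metric.ball n ρ) * (b * Real.exp (-κ / h)) ^ 2 := by
          rw [mul_pow, mul_pow, mul_pow, Real.sq_sqrt hv.le]; ring
      _ = ∫ _ in Metric.ball n ρ, (b * Real.exp (-κ / h)) ^ 2 := by simp
      _ ≤ ∫ x in Metric.ball n ρ, F h x ^ 2 := by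
          refine setIntegral_mono_on (integrableOn_const hfin.ne) h2.integrableOn
            measurableSet_ball fun x hx => ?_
          exact pow_le_pow_left₀ (by positivity) (h1 x hx) 2
      _ ≤ ∫ x, F h x ^ 2 :=
          setIntegral_le_integral h2 (.of_forall fun x => sq_nonneg _)
  refine ⟨fun κ hκ => ?_, ?_⟩
  · obtain ⟨b, hb, hev⟩ := key κ hκ
    refine IsBigO.of_bound b⁻¹ ?_
    filter_upwards [hev] with h hh
    have h1 : b * Real.exp (-κ / h) ≤ Real.sqrt (∫ x, F h x ^ 2) := Real.le_sqrt_of_sq_le hh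
    rw [Real.norm_of_nonneg (by positivity), Real.norm_of_nonneg (Real.exp_pos _).le]
    calc (Real.sqrt (∫ x, F h x ^ 2))⁻¹ ≤ (b * Real.exp (-κ / h))⁻¹ :=
          inv_anti₀ (by positivity) h1
      _ = b⁻¹ * Real.exp (κ / h) := by rw [mul_inv, ← Real.exp_neg, neg_div, neg_neg]
  · obtain ⟨b, hb, hev⟩ := key 1 one_pos
    filter_upwards [hev] with h hh
    exact lt_of_lt_of_le (by positivity) hh

variable {L : Labeling W} {a : ℝ → Space d → ℝ} {D : Choices d} {κ δ : ℝ}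

theorem eventually_param (hh₀ : 0 < h₀) : ∀ᶠ h in 𝓝[>] (0 : ℝ), 0 < h ∧ h ≤ h₀ :=
  (Ioc_mem_nhdsGT hh₀ : Ioc 0 h₀ ∈ 𝓝[>] (0 : ℝ))

/-! ### The amplitude and the global quasimode -/

theorem IsAmplitude.continuous (ha : IsAmplitude W h₀ a) {h : ℝ} (hh : 0 < h) (hh' : h ≤ h₀) :
    Continuous (a h) := by
  obtain ⟨b, hb, -⟩ := ha.expansion
  exact (contDiffOn_univ.1 (hb.smooth h hh hh')).continuous

theorem IsAmplitude.exists_le (ha : IsAmplitude W h₀ a) :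
    ∃ C > 0, ∀ h, 0 < h → h ≤ h₀ → ∀ x, a h x ≤ C := by
  obtain ⟨b, hb, -⟩ := ha.expansion
  obtain ⟨C, hC⟩ := hb.bound 0 0
  refine ⟨max C 1, by positivity, fun h hh hh' x => ?_⟩
  have := hC h hh hh' x (mem_univ x)
  simp only [norm_iteratedFDeriv_zero, Finset.range_zero, Finset.sum_empty, sub_zero, pow_zero,
    mul_one] at this
  exact (le_abs_self _).trans (this.trans (le_max_left _ _))

theorem IsAmplitude.exists_inv_le (ha : IsAmplitude W h₀ a) :
    ∃ C > 0, ∀ h, 0 < h → h ≤ h₀ → ∀ x, (a h x)⁻¹ ≤ C := by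
  obtain ⟨C, hC⟩ := ha.inv_bound 0
  refine ⟨max C 1, by positivity, fun h hh hh' x => ?_⟩
  have := hC h hh hh' x
  simp only [norm_iteratedFDeriv_zero] at this
  exact (le_abs_self _).trans (this.trans (le_max_left _ _))

theorem groundBump_pos (ha : IsAmplitude W h₀ a) {h : ℝ} (hh : 0 < h) (hh' : h ≤ h₀)
    (n x : Space d) : 0 < groundBump W a n h x :=
  mul_pos (mul_pos (inv_pos.2 (ha.pos h hh hh' x)) (Real.rpow_pos_of_pos hh _)) (Real.exp_pos _)

theorem continuous_groundBump (hW : IsPotential W h₀) (ha : IsAmplitude W h₀ a) {h : ℝ}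
    (hh : 0 < h) (hh' : h ≤ h₀) (n : Space d) : Continuous (groundBump W a n h) := by
  have h1 : Continuous fun x => (a h x)⁻¹ :=
    (ha.continuous hh hh').inv₀ fun x => (ha.pos h hh hh' x).ne'
  have h2 := hW.smooth.continuous
  unfold groundBump
  fun_prop

theorem memLp_groundBump (hW : IsPotential W h₀) (ha : IsAmplitude W h₀ a) {h : ℝ}
    (hh : 0 < h) (hh' : h ≤ h₀) (n : Space d) : MemLp (groundBump W a n h) 2 volume := by
  obtain ⟨C, hC, hCa⟩ := ha.exists_inv_le
  refine (hW.square_integrable h hh hh').of_le_mul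
    (c := C * h ^ (-(d : ℝ) / 4) * Real.exp (W n / h))
    (continuous_groundBump hW ha hh hh' n).aestronglyMeasurable (.of_forall fun x => ?_)
  have hp := Real.rpow_pos_of_pos hh (-(d : ℝ) / 4)
  rw [Real.norm_of_nonneg (groundBump_pos ha hh hh' n x).le,
    Real.norm_of_nonneg (Real.exp_pos _).le, mul_assoc, ← Real.exp_add, groundBump]
  rw [show -(W x - W n) / h = W n / h + -W x / h by ring]
  gcongr
  exact hCa h hh hh' x

theorem groundBump_mul_le (ha : IsAmplitude W h₀ a) (n n' : Space d) :
    ∃ M : ℝ → ℝ, SubExp M ∧ ∀ h, 0 < h → h ≤ h₀ → ∀ x, 0 ≤ M h ∧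
      groundBump W a n h x * groundBump W a n' h x ≤
        M h * Real.exp (-(2 * W x - W n - W n') / h) := by
  obtain ⟨C, hC, hCa⟩ := ha.exists_inv_le
  have hCs : SubExp fun _ => C := SubExp.of_bounded (C := |C|) (.of_forall fun _ => le_rfl)
  refine ⟨fun h => (C * h ^ (-(d : ℝ) / 4)) * (C * h ^ (-(d : ℝ) / 4)),
    (hCs.mul (.rpow _)).mul (hCs.mul (.rpow _)), fun h hh hh' x => ?_⟩
  have hp := Real.rpow_pos_of_pos hh (-(d : ℝ) / 4)
  have ha' := inv_pos.2 (ha.pos h hh hh' x)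
  refine ⟨by positivity, ?_⟩
  rw [show -(2 * W x - W n - W n') / h = -(W x - W n) / h + -(W x - W n') / h by ring,
    Real.exp_add, groundBump, groundBump, mul_mul_mul_comm]
  have hle := mul_le_mul_of_nonneg_right (hCa h hh hh' x) hp.le
  have h0 : 0 ≤ (a h x)⁻¹ * h ^ (-(d : ℝ) / 4) := by positivity
  exact mul_le_mul_of_nonneg_right (mul_le_mul hle hle h0 (h0.trans hle)) (by positivity)

/-- An integral against `e^{-(2 W - W n - W n') / h}` is exponentially small if the exponent is
negative, bounded away from zero, on the support of the bounded and compactly supported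
weight `u`. -/
theorem expSmall_integral_mul_groundBump (hh₀ : 0 < h₀) (ha : IsAmplitude W h₀ a)
    {n n' : Space d} {K : Set (Space d)} (hK : IsCompact K) {u : ℝ → Space d → ℝ} {B c : ℝ}
    (hc : 0 < c)
    (hu : ∀ h, 0 < h → h ≤ h₀ → ∀ x, |u h x| ≤ B ∧
      (u h x ≠ 0 → x ∈ K ∧ c ≤ 2 * W x - W n - W n')) :
    ExpSmall fun h => ∫ x, u h x * (groundBump W a n h x * groundBump W a n' h x) := by
  obtain ⟨M, hM, hMle⟩ := groundBump_mul_le ha n n'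
  have hBM : SubExp fun h => B * M h :=
    (SubExp.of_bounded (F := fun _ => B) (C := |B|) (.of_forall fun _ => le_rfl)).mul hM
  refine expSmall_integral hK.measure_lt_top hBM hc ?_ ?_
  · filter_upwards [eventually_param hh₀] with h ⟨hh, hh'⟩ x
    obtain ⟨h1, h2⟩ := hu h hh hh' x
    obtain ⟨hM0, hMx⟩ := hMle h hh hh' x
    have hB : 0 ≤ B := (abs_nonneg _).trans h1
    by_cases hux : u h x = 0
    · rw [hux, zero_mul, abs_zero]
      positivity
    · have hg := mul_pos (groundBump_pos ha hh hh' n x) (groundBump_pos ha hh hh' n' x)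
      rw [abs_mul, abs_of_pos hg, mul_assoc]
      refine mul_le_mul h1 (hMx.trans ?_) hg.le hB
      refine mul_le_mul_of_nonneg_left (Real.exp_le_exp.2 ?_) hM0
      exact div_le_div_of_nonneg_right (neg_le_neg (h2 hux).2) hh.le
  · filter_upwards [eventually_param hh₀] with h ⟨hh, hh'⟩ x hx
    rw [not_not.1 fun hne => hx ((hu h hh hh' x).2 hne).1, zero_mul]

theorem exists_le_groundBump (hh₀ : 0 < h₀) (hW : IsPotential W h₀) (ha : IsAmplitude W h₀ a)
    (n : Space d) (κ : ℝ) (hκ : 0 < κ) : ∃ ρ > 0, ∃ b > 0, ∀ᶠ h in 𝓝[>] (0 : ℝ),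
      ∀ x ∈ Metric.ball n ρ, b * Real.exp (-κ / h) ≤ groundBump W a n h x := by
  obtain ⟨C, hC, hCa⟩ := ha.exists_le
  obtain ⟨ρ, hρ, hball⟩ := Metric.eventually_nhds_iff_ball.1
    (hW.smooth.continuous.continuousAt.eventually (eventually_lt_nhds (b := W n + κ)
      (show W n < _ by linarith)))
  refine ⟨ρ, hρ, C⁻¹, inv_pos.2 hC, ?_⟩
  filter_upwards [eventually_param hh₀, eventually_param one_pos] with h ⟨hh, hh'⟩ ⟨_, hh1⟩ x hx
  have h1 : 1 ≤ h ^ (-(d : ℝ) / 4) :=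
    Real.one_le_rpow_of_pos_of_le_one_of_nonpos hh hh1
      (div_nonpos_of_nonpos_of_nonneg (neg_nonpos.2 (Nat.cast_nonneg d)) (by norm_num))
  have h2 : C⁻¹ ≤ (a h x)⁻¹ := inv_anti₀ (ha.pos h hh hh' x) (hCa h hh hh' x)
  have h3 : Real.exp (-κ / h) ≤ Real.exp (-(W x - W n) / h) := by
    have := hball x hx
    refine Real.exp_le_exp.2 (div_le_div_of_nonneg_right ?_ hh.le)
    linarith
  have h4 : C⁻¹ ≤ (a h x)⁻¹ * h ^ (-(d : ℝ) / 4) :=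
    h2.trans (le_mul_of_one_le_right (inv_pos.2 (ha.pos h hh hh' x)).le h1)
  exact mul_le_mul h4 h3 (Real.exp_pos _).le ((inv_pos.2 hC).le.trans h4)

theorem groundBump_normalization (hh₀ : 0 < h₀) (hW : IsPotential W h₀)
    (ha : IsAmplitude W h₀ a) (n : Space d) :
    SubExp (fun h => (Real.sqrt (∫ x, groundBump W a n h x ^ 2))⁻¹) ∧
      ∀ᶠ h in 𝓝[>] 0, 0 < ∫ x, groundBump W a n h x ^ 2 := by
  refine subExp_inv_sqrt_integral (n := n) ?_ (exists_le_groundBump hh₀ hW ha n)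
  filter_upwards [eventually_param hh₀] with h ⟨hh, hh'⟩
  exact (memLp_groundBump hW ha hh hh' n).integrable_sq

/-! ### The localizing factor of the quasimodes -/

/-- The factor `χ_α θ^α_{n,h}` that localizes the global quasimode to the well of `n`. -/
noncomputable def cutoff (L : Labeling W) (D : Choices d) (α : Set (Space d)) (n : Space d)
    (h : ℝ) (x : Space d) : ℝ :=
  D.χ α x * D.θ L α n h x

theorem bump_eq (α : Set (Space d)) (n : Space d) (h : ℝ) (x : Space d) :
    D.bump L a α n h x = cutoff L D α n h x * groundBump W a n h x := by
  simp only [Choices.bump, cutoff, groundBump]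
  ring

/-- A crude bound, sufficient here; in fact `θ` takes values in `[0, 1]`. -/
theorem abs_θ_le (hD : IsAdmissible L h₀ a D) (α : Set (Space d)) (n : Space d) (h : ℝ)
    (x : Space d) : |D.θ L α n h x| ≤ 2 := by
  unfold Choices.θ
  split_ifs with h1 h2
  · set g : ℝ → ℝ := fun t => D.ζ t * Real.exp (-t ^ 2 / (2 * h)) with hg
    have hg0 : ∀ t, 0 ≤ g t := fun t => mul_nonneg (hD.ζ_mem t).1 (Real.exp_pos _).le
    have hgc : Continuous g := by
      have := hD.ζ_smooth.continuous
      fun_prop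
    have hgs : HasCompactSupport g :=
      HasCompactSupport.mul_right
        (isCompact_Icc.of_isClosed_subset (isClosed_tsupport _) hD.ζ_support)
    have hgi : Integrable g := hgc.integrable_of_hasCompactSupport hgs
    have hA : D.A h = 1 / 2 * ∫ t, g t := rfl
    have hA0 : 0 ≤ D.A h := by
      rw [hA]
      exact mul_nonneg (by norm_num) (integral_nonneg hg0)
    have hle : ∀ y : ℝ, |∫ t in (0 : ℝ)..y, g t| ≤ 2 * D.A h := by
      intro y
      rw [hA]
      calc |∫ t in (0 : ℝ)..y, g t| ≤ ∫ t in uIoc 0 y, ‖g t‖ := by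
            rw [← Real.norm_eq_abs]
            exact intervalIntegral.norm_integral_le_integral_norm_uIoc
        _ = ∫ t in uIoc 0 y, g t := by simp only [Real.norm_of_nonneg (hg0 _)]
        _ ≤ ∫ t, g t := setIntegral_le_integral hgi (.of_forall hg0)
        _ = _ := by ring
    have h3 : |(D.A h)⁻¹ * ∫ t in (0 : ℝ)..(D.ℓ h1.choose n h x), g t| ≤ 2 := by
      rw [abs_mul, abs_of_nonneg (inv_nonneg.2 hA0)]
      refine (mul_le_mul_of_nonneg_left (hle _) (inv_nonneg.2 hA0)).trans ?_
      have := inv_mul_le_one_of_le₀ (le_refl (D.A h)) hA0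
      linarith
    have := abs_le.1 h3
    rw [abs_le]
    constructor <;> linarith [this.1, this.2]
  · norm_num
  · norm_num

theorem abs_cutoff_le (hD : IsAdmissible L h₀ a D) {α : Set (Space d)} (hα : α ∈ L.classes)
    (n : Space d) (h : ℝ) (x : Space d) : |cutoff L D α n h x| ≤ 2 := by
  have h1 := hD.χ_mem α hα x
  rw [cutoff, abs_mul, abs_of_nonneg h1.1]
  calc D.χ α x * |D.θ L α n h x| ≤ 1 * 2 :=
        mul_le_mul h1.2 (abs_θ_le hD α n h x) (abs_nonneg _) zero_le_one
    _ = 2 := one_mul 2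

theorem cutoff_eq_zero {α : Set (Space d)} {n x : Space d} {h : ℝ} (hx : x ∉ tsupport (D.χ α)) :
    cutoff L D α n h x = 0 := by
  rw [cutoff, image_eq_zero_of_notMem_tsupport hx, zero_mul]

theorem continuous_cutoff (hD : IsAdmissible L h₀ a D) {h : ℝ} (hh : 0 < h) (hh' : h ≤ h₀)
    {α : Set (Space d)} (hα : α ∈ L.classes) {n : Space d} (hn : n ∈ L.hatClass α) :
    Continuous (cutoff L D α n h) := by
  obtain ⟨U, hU, hχU, hθ⟩ := hD.θ_smooth α hα n hn h hh hh'
  refine continuous_of_tsupport fun x hx => ?_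
  have hxχ : x ∈ tsupport (D.χ α) := tsupport_mul_subset_left hx
  exact (hD.χ_smooth α hα).continuous.continuousAt.mul
    (hθ.continuousOn.continuousAt (hU.mem_nhds (hχU hxχ)))

theorem continuous_bump (hW : IsPotential W h₀) (ha : IsAmplitude W h₀ a)
    (hD : IsAdmissible L h₀ a D) {h : ℝ} (hh : 0 < h) (hh' : h ≤ h₀)
    {α : Set (Space d)} (hα : α ∈ L.classes) {n : Space d} (hn : n ∈ L.hatClass α) :
    Continuous (D.bump L a α n h) :=
  ((continuous_cutoff hD hh hh' hα hn).mul (continuous_groundBump hW ha hh hh' n)).congr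
    fun x => (bump_eq α n h x).symm

theorem memLp_bump (hW : IsPotential W h₀) (ha : IsAmplitude W h₀ a)
    (hD : IsAdmissible L h₀ a D) {h : ℝ} (hh : 0 < h) (hh' : h ≤ h₀)
    {α : Set (Space d)} (hα : α ∈ L.classes) {n : Space d} (hn : n ∈ L.hatClass α) :
    MemLp (D.bump L a α n h) 2 volume := by
  refine (continuous_bump hW ha hD hh hh' hα hn).memLp_of_hasCompactSupport ?_
  refine HasCompactSupport.intro (hD.χ_compact α hα) fun x hx => ?_
  rw [bump_eq, cutoff_eq_zero hx, zero_mul]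

section Localization

variable (hW : IsPotential W h₀) (hD : IsAdmissible L h₀ a D) (hG : IsGap L κ δ)
  (hr : D.r < δ) (hε : D.ε < δ) {m n x : Space d} (hm : m ∈ L.excited)

include hW hG hr hm in
/-- The saddle points do not matter at energies below `σ k - κ`. -/
theorem not_near_saddle (hx : W x ≤ L.level (L.rank m) - κ) :
    ¬ ∃ s, s ∈ L.saddles (L.cls m) n ∧ x ∈ Metric.ball s D.r ∧
      |D.ℓcoeff s n 0 x| ≤ 2 * D.γ := by
  rintro ⟨s, ⟨hs, -⟩, hxs, -⟩
  have hk := Labeling.two_le_rank hm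
  rw [Labeling.well_cls hm, Labeling.T, ← Labeling.coe_level hk] at hs
  have hsW := eq_of_mem_frontier_component hW.smooth.continuous hs
  have := (abs_lt.1 (hG.osc _ hk x s hsW.le (lt_trans hxs hr))).1
  linarith

include hW hD hG hr hm in
theorem θ_eq_one {h : ℝ} (hx : W x ≤ L.level (L.rank m) - κ) (hxT : x ∈ L.T (L.rank m) n) :
    D.θ L (L.cls m) n h x = 1 := by
  rw [Choices.θ, dif_neg (not_near_saddle hW hG hr hm hx), if_pos]
  rw [Labeling.well_cls hm]
  exact Metric.self_subset_thickening hD.ε_pos _ hxT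

include hW hG hr hε hm in
theorem mem_T_of_θ_ne_zero {h : ℝ} (hx : W x ≤ L.level (L.rank m) - κ)
    (hθ : D.θ L (L.cls m) n h x ≠ 0) : x ∈ L.T (L.rank m) n := by
  rw [Choices.θ, dif_neg (not_near_saddle hW hG hr hm hx), Labeling.well_cls hm] at hθ
  split_ifs at hθ with hth
  · obtain ⟨y, hy, hxy⟩ := Metric.mem_thickening_iff.1 hth
    by_contra hxT
    have := hG.lt_of_notMem_T hW.smooth.continuous (Labeling.two_le_rank hm) hy hxT
      (hxy.trans hε)
    linarith
  · exact absurd rfl hθ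

include hD hm in
theorem mem_Ω (hn : n ∈ L.hatClass (L.cls m)) : n ∈ D.Ω (L.cls m) :=
  (hD.Ω_component _ (Labeling.cls_mem_classes hm)).2 hn

include hD hm in
theorem isPreconnected_Ω : IsPreconnected (D.Ω (L.cls m)) := by
  obtain ⟨y, -, hy⟩ := (hD.Ω_component _ (Labeling.cls_mem_classes hm)).1
  rw [hy]
  exact isPreconnected_connectedComponentIn

include hD hm in
theorem le_of_mem_Ω : ∀ y ∈ D.Ω (L.cls m), W y ≤ L.level (L.rank m) := by
  intro x hx
  obtain ⟨y, -, hy⟩ := (hD.Ω_component _ (Labeling.cls_mem_classes hm)).1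
  rw [hy, Labeling.classLevel_cls hm] at hx
  have : x ∈ {x | W x ≤ L.level (L.rank m)} := connectedComponentIn_subset _ _ hx
  exact this

include hD hm in
theorem T_subset_Ω (hn : n ∈ L.upTo (L.rank m)) (hnΩ : n ∈ D.Ω (L.cls m)) :
    L.T (L.rank m) n ⊆ D.Ω (L.cls m) := by
  obtain ⟨y, -, hy⟩ := (hD.Ω_component _ (Labeling.cls_mem_classes hm)).1
  rw [hy] at hnΩ ⊢
  rw [connectedComponentIn_eq hnΩ]
  refine isPreconnected_connectedComponentIn.subset_connectedComponentIn (Labeling.mem_T hn) ?_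
  intro z hz
  have hz' : z ∈ below W (L.σ (L.rank m)) := connectedComponentIn_subset _ _ hz
  rw [← Labeling.coe_level (Labeling.two_le_rank hm)] at hz'
  rw [Labeling.classLevel_cls hm]
  exact (EReal.coe_lt_coe_iff.1 hz').le

include hD hm in
theorem χ_eq_one (hx : W x ≤ L.level (L.rank m)) (hxΩ : x ∈ D.Ω (L.cls m)) :
    D.χ (L.cls m) x = 1 := by
  have hα := Labeling.cls_mem_classes hm
  refine hD.χ_one _ hα x (Metric.self_subset_thickening hD.ε_pos _ hxΩ) ?_
  rw [Labeling.classLevel_cls hm]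
  linarith [hD.gap_pos _ hα]

include hW hD hG hr hm in
theorem cutoff_eq_one {h : ℝ} (hn : n ∈ L.hatClass (L.cls m))
    (hx : W x ≤ L.level (L.rank m) - κ) (hxT : x ∈ L.T (L.rank m) n) :
    cutoff L D (L.cls m) n h x = 1 := by
  rw [cutoff, θ_eq_one hW hD hG hr hm hx hxT, mul_one]
  exact χ_eq_one hD hm (by linarith [hG.κ_pos])
    (T_subset_Ω hD hm (Labeling.hatClass_subset m hn) (mem_Ω hD hm hn) hxT)

include hW hG hr hε hm in
theorem mem_T_of_cutoff_ne_zero {h : ℝ} (hx : W x ≤ L.level (L.rank m) - κ)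
    (hne : cutoff L D (L.cls m) n h x ≠ 0) : x ∈ L.T (L.rank m) n :=
  mem_T_of_θ_ne_zero hW hG hr hε hm hx (right_ne_zero_of_mul hne)

include hW hG hr hε hm in
theorem le_of_cutoff_ne_zero {h : ℝ} (hn : n ∈ L.hatClass (L.cls m))
    (hne : cutoff L D (L.cls m) n h x ≠ 0) : W n ≤ W x := by
  have hk := Labeling.two_le_rank hm
  have hn' := Labeling.hatClass_subset m hn
  by_cases hx : W x ≤ L.level (L.rank m) - κ
  · exact Labeling.le_of_mem_T hk.2 hn' (mem_T_of_cutoff_ne_zero hW hG hr hε hm hx hne)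
  · linarith [hG.minima _ hk n hn', hG.κ_pos]

include hW hD hG hr hm in
theorem bump_normalization (hh₀ : 0 < h₀) (ha : IsAmplitude W h₀ a)
    (hn : n ∈ L.hatClass (L.cls m)) :
    SubExp (D.c L a (L.cls m) n) ∧
      ∀ᶠ h in 𝓝[>] 0, 0 < ∫ x, D.bump L a (L.cls m) n h x ^ 2 := by
  have hk := Labeling.two_le_rank hm
  have hn' := Labeling.hatClass_subset m hn
  refine subExp_inv_sqrt_integral (n := n) ?_ fun η hη => ?_
  · filter_upwards [eventually_param hh₀] with h ⟨hh, hh'⟩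
    exact (memLp_bump hW ha hD hh hh' (Labeling.cls_mem_classes hm) hn).integrable_sq
  · obtain ⟨ρ, hρ, b, hb, hev⟩ := exists_le_groundBump hh₀ hW ha n η hη
    have hWc := hW.smooth.continuous
    have hnear : ∀ᶠ x in 𝓝 n, W x < L.level (L.rank m) - κ ∧ x ∈ L.T (L.rank m) n := by
      have h1 := hG.minima _ hk n hn'
      have h2 := hG.κ_pos
      exact (hWc.continuousAt.eventually (eventually_lt_nhds (show W n < _ by linarith))).and
        ((isOpen_component hWc _ _).mem_nhds (Labeling.mem_T hn'))
    obtain ⟨ρ', hρ', hball⟩ := Metric.eventually_nhds_iff_ball.1 hnear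
    refine ⟨min ρ ρ', lt_min hρ hρ', b, hb, ?_⟩
    filter_upwards [hev] with h hh x hx
    obtain ⟨h1, h2⟩ := hball x (Metric.ball_subset_ball (min_le_right _ _) hx)
    rw [bump_eq, cutoff_eq_one hW hD hG hr hm hn h1.le h2, one_mul]
    exact hh x (Metric.ball_subset_ball (min_le_left _ _) hx)

end Localization

/-! ### Interactions between localized quasimodes -/

section Interactions

variable (hh₀ : 0 < h₀) (hW : IsPotential W h₀) (ha : IsAmplitude W h₀ a)
  (hD : IsAdmissible L h₀ a D) (hG : IsGap L κ δ) (hr : D.r < δ) (hε : D.ε < δ)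
  {m m' n n' : Space d} (hm : m ∈ L.excited) (hm' : m' ∈ L.excited)

include hh₀ hW ha hD hG hr hε hm hm' in
/-- At a common level, the localizations to different wells overlap only at energies near
`σ k`. -/
theorem expSmall_integral_bump_mul_bump (hrank : L.rank m = L.rank m')
    (hn : n ∈ L.hatClass (L.cls m)) (hn' : n' ∈ L.hatClass (L.cls m')) (hnn' : n ≠ n') :
    ExpSmall fun h => ∫ x, D.bump L a (L.cls m) n h x * D.bump L a (L.cls m') n' h x := by
  have hα := Labeling.cls_mem_classes hm
  have hα' := Labeling.cls_mem_classes hm'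
  have hk := Labeling.two_le_rank hm
  have hnk := Labeling.hatClass_subset m hn
  have hnk' : n' ∈ L.upTo (L.rank m) := hrank ▸ Labeling.hatClass_subset m' hn'
  refine (expSmall_integral_mul_groundBump hh₀ ha (n := n) (n' := n') (hD.χ_compact _ hα)
    (u := fun h x => cutoff L D (L.cls m) n h x * cutoff L D (L.cls m') n' h x) (B := 2 * 2)
    (c := 2 * κ) (mul_pos two_pos hG.κ_pos) fun h hh hh' x => ⟨?_, fun hne => ⟨?_, ?_⟩⟩).congr
    (.of_forall fun h => ?_)
  · rw [abs_mul]
    exact mul_le_mul (abs_cutoff_le hD hα _ _ _) (abs_cutoff_le hD hα' _ _ _) (abs_nonneg _)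
      zero_le_two
  · by_contra hx
    exact left_ne_zero_of_mul hne (cutoff_eq_zero hx)
  · have hx : L.level (L.rank m) - κ < W x := by
      by_contra! hx
      refine hnn' (Labeling.disjoint_T ⟨by have := hk.1; omega, hk.2⟩ hnk hnk'
        (mem_T_of_cutoff_ne_zero hW hG hr hε hm hx (left_ne_zero_of_mul hne)) ?_)
      rw [hrank] at hx ⊢
      exact mem_T_of_cutoff_ne_zero hW hG hr hε hm' hx (right_ne_zero_of_mul hne)
    linarith [hG.minima _ hk n hnk, hG.minima _ hk n' hnk']
  · refine integral_congr_ae (.of_forall fun x => ?_)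
    simp only [bump_eq]
    ring

include hD hG hε hm in
theorem exists_mem_Ω_near {x : Space d} (hx : x ∈ tsupport (D.χ (L.cls m))) :
    ∃ y ∈ D.Ω (L.cls m), dist x y < δ ∧ W y ≤ L.level (L.rank m) ∧
      W x < L.level (L.rank m) + κ := by
  obtain ⟨y, hy, hxy⟩ := Metric.mem_thickening_iff.1
    (hD.χ_support _ (Labeling.cls_mem_classes hm) hx)
  have hyW := le_of_mem_Ω hD hm y hy
  have := abs_lt.1 (hG.osc _ (Labeling.two_le_rank hm) x y hyW (hxy.trans hε))
  exact ⟨y, hy, hxy.trans hε, hyW, by linarith [this.2]⟩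

include hW hD hG hr hε hm hm' in
theorem cutoff_eq_one_of_subset (hrank : L.rank m' < L.rank m)
    (hn' : n' ∈ L.hatClass (L.cls m')) (hsub : D.Ω (L.cls m) ⊆ L.T (L.rank m') n')
    {h : ℝ} {x : Space d} (hx : x ∈ tsupport (D.χ (L.cls m))) :
    cutoff L D (L.cls m') n' h x = 1 := by
  have hk := Labeling.two_le_rank hm
  have hk' := Labeling.two_le_rank hm'
  obtain ⟨y, hy, hxy, hyW, hxW⟩ := exists_mem_Ω_near hD hG hε hm hx
  have hlev := hG.levels _ hk _ hk' hrank
  have hxW' : W x ≤ L.level (L.rank m') - κ := by linarith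
  refine cutoff_eq_one hW hD hG hr hm' hn' hxW' ?_
  by_contra hxT
  linarith [hG.lt_of_notMem_T hW.smooth.continuous hk' (hsub hy) hxT hxy]

include hW hD hG hr hε hm hm' in
theorem cutoff_eq_zero_of_not_subset (hrank : L.rank m' < L.rank m)
    (hsub : ¬ D.Ω (L.cls m) ⊆ L.T (L.rank m') n')
    {h : ℝ} {x : Space d} (hx : x ∈ tsupport (D.χ (L.cls m))) :
    cutoff L D (L.cls m') n' h x = 0 := by
  have hk := Labeling.two_le_rank hm
  have hk' := Labeling.two_le_rank hm'
  obtain ⟨y, hy, hxy, hyW, hxW⟩ := exists_mem_Ω_near hD hG hε hm hx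
  have hlev := hG.levels _ hk _ hk' hrank
  by_contra hne
  have hxT := mem_T_of_cutoff_ne_zero hW hG hr hε hm' (by linarith) hne
  refine hsub (Labeling.subset_T hk (by have := hk'.1; omega) hrank (isPreconnected_Ω hD hm)
    (le_of_mem_Ω hD hm) hy ?_)
  by_contra hyT
  rw [dist_comm] at hxy
  linarith [hG.lt_of_notMem_T hW.smooth.continuous hk' hxT hyT hxy, hG.κ_pos]

include hh₀ hW ha hD hG hr hε hm in
theorem expSmall_integral_bump_mul_groundBump (hn : n ∈ L.hatClass (L.cls m))
    (hlt : W n' < W n) :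
    ExpSmall fun h => ∫ x, D.bump L a (L.cls m) n h x * groundBump W a n' h x := by
  have hα := Labeling.cls_mem_classes hm
  refine (expSmall_integral_mul_groundBump hh₀ ha (n := n) (n' := n') (hD.χ_compact _ hα)
    (u := cutoff L D (L.cls m) n) (B := 2) (sub_pos.2 hlt)
    fun h hh hh' x => ⟨abs_cutoff_le hD hα _ _ _, fun hne => ⟨?_, ?_⟩⟩).congr
    (.of_forall fun h => ?_)
  · by_contra hx
    exact hne (cutoff_eq_zero hx)
  · linarith [le_of_cutoff_ne_zero hW hG hr hε hm hn hne]
  · refine integral_congr_ae (.of_forall fun x => ?_)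
    simp only [bump_eq]
    ring

include hh₀ hW ha hD hG hr hε hm in
/-- The cutoff `χ θ` of a well differs from its square only at energies near `σ k`. -/
theorem expSmall_integral_bump_mul_groundBump_sub (hn : n ∈ L.hatClass (L.cls m))
    (heq : W n' = W n) :
    ExpSmall fun h => (∫ x, D.bump L a (L.cls m) n h x * groundBump W a n' h x) -
      ∫ x, D.bump L a (L.cls m) n h x ^ 2 := by
  have hα := Labeling.cls_mem_classes hm
  have hk := Labeling.two_le_rank hm
  have hnk := Labeling.hatClass_subset m hn
  have hgr : groundBump W a n' = groundBump W a n := by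
    funext h x
    rw [groundBump, groundBump, heq]
  refine (expSmall_integral_mul_groundBump hh₀ ha (n := n) (n' := n) (hD.χ_compact _ hα)
    (u := fun h x => cutoff L D (L.cls m) n h x * (1 - cutoff L D (L.cls m) n h x))
    (B := 2 * 3) (c := 2 * κ) (mul_pos two_pos hG.κ_pos)
    fun h hh hh' x => ⟨?_, fun hne => ⟨?_, ?_⟩⟩).congr ?_
  · rw [abs_mul]
    have h1 := abs_cutoff_le hD hα n h x
    refine mul_le_mul h1 ?_ (abs_nonneg _) zero_le_two
    rw [abs_le] at h1 ⊢
    constructor <;> linarith [h1.1, h1.2]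
  · by_contra hx
    exact left_ne_zero_of_mul hne (cutoff_eq_zero hx)
  · have hx : L.level (L.rank m) - κ < W x := by
      by_contra! hx
      have hxT := mem_T_of_cutoff_ne_zero hW hG hr hε hm hx (left_ne_zero_of_mul hne)
      refine right_ne_zero_of_mul hne ?_
      rw [cutoff_eq_one hW hD hG hr hm hn hx hxT, sub_self]
    linarith [hG.minima _ hk n hnk]
  · filter_upwards [eventually_param hh₀] with h ⟨hh, hh'⟩
    have hb := memLp_bump hW ha hD hh hh' hα hn
    have hi : Integrable fun x => D.bump L a (L.cls m) n h x * groundBump W a n h x :=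
      hb.integrable_mul (memLp_groundBump hW ha hh hh' n)
    rw [hgr, ← integral_sub hi hb.integrable_sq]
    refine integral_congr_ae (.of_forall fun x => ?_)
    simp only [bump_eq]
    ring

end Interactions

/-! ### The coefficients of the quasimodes -/

section Coefficients

variable (hW : IsPotential W h₀) (hD : IsAdmissible L h₀ a D) {m n : Space d}
  (hm : m ∈ L.excited) {h : ℝ} (hh : 0 < h) (hh' : h ≤ h₀)

/-- The enlarged class `𝒰_α ∪ {hat m}` of `m`, as a finite set. -/
noncomputable def hatFinset (hW : IsPotential W h₀) (L : Labeling W) (m : Space d) :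
    Finset (Space d) :=
  (L.hatClass_finite (hW.finite_crit 0 (Nat.zero_le _)) m).toFinset

theorem mem_hatFinset : n ∈ hatFinset hW L m ↔ n ∈ L.hatClass (L.cls m) :=
  Set.Finite.mem_toFinset _

theorem finsum_hatClass (F : Space d → ℝ) :
    ∑ᶠ n ∈ L.hatClass (L.cls m), F n = ∑ n ∈ hatFinset hW L m, F n :=
  finsum_mem_eq_finite_toFinset_sum _ _

include hW hD hm hh hh' in
theorem abs_φ_le (hn : n ∈ L.hatClass (L.cls m)) : |D.φ (L.cls m) h m n| ≤ 1 := by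
  have h1 := hD.φ_norm _ (Labeling.cls_mem_classes hm) h hh hh' m (Labeling.mem_hatClass hm)
  rw [finsum_hatClass hW] at h1
  have h2 := Finset.single_le_sum (f := fun n => D.φ (L.cls m) h m n * D.φ (L.cls m) h m n)
    (fun j _ => mul_self_nonneg _) ((mem_hatFinset hW).2 hn)
  rw [h1] at h2
  exact abs_le_one_iff_mul_self_le_one.2 h2

include hW hD hm hh hh' in
theorem quasimode_eq_sum (x : Space d) :
    quasimode L a D m h x = ∑ n ∈ hatFinset hW L m,
      D.φ (L.cls m) h m n * D.c L a (L.cls m) n h * D.bump L a (L.cls m) n h x := by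
  rw [quasimode, if_neg hm.2, finsum_hatClass hW, Finset.mul_sum, Finset.sum_mul]
  refine Finset.sum_congr rfl fun n hn => ?_
  by_cases h0 : D.φ (L.cls m) h m n = 0
  · simp [h0]
  · rw [Choices.bump, hD.φ_ne_zero _ (Labeling.cls_mem_classes hm) h hh hh' m
      (Labeling.mem_hatClass hm) n ((mem_hatFinset hW).1 hn) h0]
    ring

include hD hm in
theorem hat_eq_of_mem_cls (hn : n ∈ L.cls m) : L.hat n = L.hat m :=
  (Labeling.hat_eq hm (Labeling.Rel.rank_eq hn) (isPreconnected_Ω hD hm) (le_of_mem_Ω hD hm)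
    (mem_Ω hD hm (Labeling.mem_hatClass hm)) (mem_Ω hD hm (Or.inl hn))).symm

include hD hm hh hh' in
theorem isTypeII_of_φ_hat_ne_zero (hne : D.φ (L.cls m) h m (L.hat m) ≠ 0) : L.IsTypeII m := by
  refine ⟨hm, le_antisymm (Labeling.W_hat_le hm) (not_lt.1 fun hlt => hne ?_)⟩
  exact (hD.φ_typeI _ (Labeling.cls_mem_classes hm) h hh hh' m (Labeling.mem_hatClass hm) _
    (Labeling.hat_mem_hatClass hm) (Or.inl ⟨Labeling.mem_cls hm, hm, hlt⟩)).2
    (Labeling.hat_ne hm)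

include hW hD hm hh hh' in
/-- Orthogonality of `φ_m` to `φ_{hat m}`, which is proportional to `1 / c` off the minima of
type I, where `φ_m` vanishes. -/
theorem sum_φ_div_c_eq_zero (hII : L.IsTypeII m) :
    ∑ n ∈ hatFinset hW L m, D.φ (L.cls m) h m n * (D.c L a (L.cls m) n h)⁻¹ = 0 := by
  have hα := Labeling.cls_mem_classes hm
  have hmm := Labeling.mem_hatClass hm
  have hhat := Labeling.hat_mem_hatClass hm
  obtain ⟨C, hC⟩ := hD.φ_hat _ hα h hh hh' m (Labeling.mem_cls hm)
  have horth := hD.φ_orth _ hα h hh hh' m hmm _ hhat (Labeling.hat_ne hm)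
  have hnorm := hD.φ_norm _ hα h hh hh' _ hhat
  rw [finsum_hatClass hW] at horth hnorm
  have hterm : ∀ n ∈ hatFinset hW L m,
      D.φ (L.cls m) h m n * D.φ (L.cls m) h (L.hat m) n =
        C * (D.φ (L.cls m) h m n * (D.c L a (L.cls m) n h)⁻¹) := by
    intro n hn
    have hn' := (mem_hatFinset hW).1 hn
    by_cases hI : n ∈ L.cls m ∧ L.IsTypeI n
    · have hmn : m ≠ n := by
        rintro rfl
        exact hI.2.2.ne hII.2
      rw [(hD.φ_typeI _ hα h hh hh' m hmm n hn' (Or.inr hI)).2 hmn]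
      ring
    · rw [(hC n hn').2 hI]
      ring
  rw [Finset.sum_congr rfl hterm, ← Finset.mul_sum] at horth
  refine (mul_eq_zero.1 horth).resolve_left fun hC0 => ?_
  have : ∀ n ∈ hatFinset hW L m,
      D.φ (L.cls m) h (L.hat m) n * D.φ (L.cls m) h (L.hat m) n = 0 := by
    intro n hn
    have hn' := (mem_hatFinset hW).1 hn
    by_cases hI : n ∈ L.cls m ∧ L.IsTypeI n
    · rw [(hC n hn').1 hI.1 hI.2, zero_mul]
    · rw [(hC n hn').2 hI, hC0, zero_mul, zero_mul]
  rw [Finset.sum_eq_zero this] at hnorm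
  exact zero_ne_one hnorm

include hW hD hm hh hh' in
/-- Quasimodes of different classes at the same level have no well in common: two minima of type
II with the same hat are equivalent. -/
theorem φ_mul_φ_eq_zero {m' : Space d} (hm' : m' ∈ L.excited) (hrank : L.rank m = L.rank m')
    (hcls : L.cls m ≠ L.cls m') (hn : n ∈ L.hatClass (L.cls m))
    (hn' : n ∈ L.hatClass (L.cls m')) :
    D.φ (L.cls m) h m n * D.φ (L.cls m') h m' n = 0 := by
  by_contra hne
  have hne1 := left_ne_zero_of_mul hne
  have hne2 := right_ne_zero_of_mul hne
  have hΩm := mem_Ω hD hm (Labeling.mem_hatClass hm)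
  have hΩn := mem_Ω hD hm hn
  have hΩm' := mem_Ω hD hm' (Labeling.mem_hatClass hm')
  have hΩn' := mem_Ω hD hm' hn'
  rcases hn with hn | ⟨p, hp, rfl⟩
  · rcases hn' with hn' | ⟨p', hp', rfl⟩
    · exact hcls (Labeling.cls_eq (Labeling.Rel.trans hn (Labeling.Rel.symm hn')))
    · have h1 := Labeling.rank_hat_lt (Labeling.Rel.symm hp').1
      have h2 := Labeling.Rel.rank_eq hn
      have h3 := Labeling.Rel.rank_eq hp'
      omega
  · rw [hat_eq_of_mem_cls hD hm hp] at *
    have hII := isTypeII_of_φ_hat_ne_zero hD hm hh hh' hne1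
    have hΩ := (hD.Ω_component _ (Labeling.cls_mem_classes hm)).1
    have hΩ' := (hD.Ω_component _ (Labeling.cls_mem_classes hm')).1
    rw [Labeling.classLevel_cls hm] at hΩ
    rw [Labeling.classLevel_cls hm', ← hrank] at hΩ'
    have hΩeq : D.Ω (L.cls m) = D.Ω (L.cls m') := by
      obtain ⟨y, -, hy⟩ := hΩ
      obtain ⟨y', -, hy'⟩ := hΩ'
      rw [hy] at hΩn ⊢
      rw [hy'] at hΩn' ⊢
      rw [connectedComponentIn_eq hΩn, connectedComponentIn_eq hΩn']
    exact hcls (Labeling.cls_eq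
      (Labeling.rel_of_mem_component hW hII hm' hrank hΩ hΩm (hΩeq ▸ hΩm')))

end Coefficients

/-! ### Almost orthonormality -/

section Gram

variable (hh₀ : 0 < h₀) (hW : IsPotential W h₀) (ha : IsAmplitude W h₀ a)
  (hD : IsAdmissible L h₀ a D) (hG : IsGap L κ δ) (hr : D.r < δ) (hε : D.ε < δ)
  {m m' n n' : Space d} (hm : m ∈ L.excited) (hm' : m' ∈ L.excited)

include hW ha hD hm in
theorem memLp_quasimode {h : ℝ} (hh : 0 < h) (hh' : h ≤ h₀) :
    MemLp (quasimode L a D m h) 2 volume := by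
  have : quasimode L a D m h = fun x => ∑ n ∈ hatFinset hW L m,
      D.φ (L.cls m) h m n * D.c L a (L.cls m) n h * D.bump L a (L.cls m) n h x :=
    funext fun x => quasimode_eq_sum hW hD hm hh hh' x
  rw [this]
  exact memLp_finsetSum _ fun n hn => (memLp_bump hW ha hD hh hh'
    (Labeling.cls_mem_classes hm) ((mem_hatFinset hW).1 hn)).const_mul _

include hh₀ hW hD hm in
theorem subExp_φ (hn : n ∈ L.hatClass (L.cls m)) : SubExp fun h => D.φ (L.cls m) h m n := by
  refine SubExp.of_bounded (C := 1) ?_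
  filter_upwards [eventually_param hh₀] with h ⟨hh, hh'⟩
  exact abs_φ_le hW hD hm hh hh' hn

include hh₀ hW ha hD hG hr hm in
theorem subExp_φ_mul_c (hn : n ∈ L.hatClass (L.cls m)) :
    SubExp fun h => D.φ (L.cls m) h m n * D.c L a (L.cls m) n h :=
  (subExp_φ hh₀ hW hD hm hn).mul (bump_normalization hW hD hG hr hm hh₀ ha hn).1

include hW ha hD hm in
theorem integral_quasimode_mul {h : ℝ} (hh : 0 < h) (hh' : h ≤ h₀) {g : Space d → ℝ}
    (hg : MemLp g 2 volume) :
    ∫ x, quasimode L a D m h x * g x = ∑ n ∈ hatFinset hW L m,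
      D.φ (L.cls m) h m n * D.c L a (L.cls m) n h *
        ∫ x, D.bump L a (L.cls m) n h x * g x := by
  simp_rw [quasimode_eq_sum hW hD hm hh hh', Finset.sum_mul, mul_assoc]
  rw [integral_finsetSum]
  · simp_rw [integral_const_mul]
  · intro n hn
    have := (memLp_bump hW ha hD hh hh' (Labeling.cls_mem_classes hm)
      ((mem_hatFinset hW).1 hn)).integrable_mul hg
    exact (this.const_mul _).const_mul _

theorem c_mul_integral_bump_sq {α : Set (Space d)} {h : ℝ} :
    D.c L a α n h * ∫ x, D.bump L a α n h x ^ 2 = (D.c L a α n h)⁻¹ := by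
  rw [Choices.c, inv_inv, inv_mul_eq_div, Real.div_sqrt]

include hh₀ hW ha hD hG hr hε hm in
/-- A quasimode is almost orthogonal to the global quasimode centred at a minimum `n'` that
dominates it, i.e. whose component at a higher level contains `Ω_α`. If `W n' < W m`, this is
due to the weights; otherwise `m` is of type II, and the sum of the contributions of the wells
cancels by the choice of the coefficients. -/
theorem expSmall_integral_quasimode_mul_groundBump {l : ℕ} (hlm : l < L.rank m)
    (hn' : n' ∈ L.upTo l) (hsub : D.Ω (L.cls m) ⊆ L.T l n') :
    ExpSmall fun h => ∫ x, quasimode L a D m h x * groundBump W a n' h x := by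
  have hα := Labeling.cls_mem_classes hm
  have hk := Labeling.two_le_rank hm
  have hle : ∀ n ∈ L.hatClass (L.cls m), W n' ≤ W n := fun n hn =>
    Labeling.le_of_mem_T (hlm.le.trans hk.2) hn' (hsub (mem_Ω hD hm hn))
  have hexp : ∀ᶠ h in 𝓝[>] 0, ∑ n ∈ hatFinset hW L m,
      D.φ (L.cls m) h m n * D.c L a (L.cls m) n h *
        ∫ x, D.bump L a (L.cls m) n h x * groundBump W a n' h x =
      ∫ x, quasimode L a D m h x * groundBump W a n' h x := by
    filter_upwards [eventually_param hh₀] with h ⟨hh, hh'⟩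
    rw [integral_quasimode_mul hW ha hD hm hh hh' (memLp_groundBump hW ha hh hh' n')]
  have hzero : ∀ n ∈ L.hatClass (L.cls m), W n ≠ W m →
      ∀ᶠ h in 𝓝[>] 0, 0 = D.φ (L.cls m) h m n := fun n hn hne => by
    filter_upwards [eventually_param hh₀] with h ⟨hh, hh'⟩
    by_contra h0
    exact hne (hD.φ_ne_zero _ hα h hh hh' m (Labeling.mem_hatClass hm) n hn (Ne.symm h0)).symm
  rcases (hle m (Labeling.mem_hatClass hm)).lt_or_eq with hlt | heq
  · refine (ExpSmall.sum fun n hn => ?_).congr hexp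
    have hn := (mem_hatFinset hW).1 hn
    by_cases hnm : W n = W m
    · exact (expSmall_integral_bump_mul_groundBump hh₀ hW ha hD hG hr hε hm hn
        (hnm ▸ hlt)).subExp_mul (subExp_φ_mul_c hh₀ hW ha hD hG hr hm hn)
    · refine ExpSmall.zero.congr ?_
      filter_upwards [hzero n hn hnm] with h h0
      rw [← h0, zero_mul, zero_mul]
  · have hII : L.IsTypeII m := ⟨hm, le_antisymm (Labeling.W_hat_le hm)
      (heq ▸ hle _ (Labeling.hat_mem_hatClass hm))⟩
    -- up to the vanishing sum of the `φ / c`, each term is the error made by replacing the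
    -- global quasimode by the normalized localized one
    have hterms : ExpSmall fun h => ∑ n ∈ hatFinset hW L m,
        D.φ (L.cls m) h m n * D.c L a (L.cls m) n h *
          ((∫ x, D.bump L a (L.cls m) n h x * groundBump W a n' h x) -
            ∫ x, D.bump L a (L.cls m) n h x ^ 2) := by
      refine ExpSmall.sum fun n hn => ?_
      have hn := (mem_hatFinset hW).1 hn
      by_cases hnm : W n = W m
      · exact (expSmall_integral_bump_mul_groundBump_sub hh₀ hW ha hD hG hr hε hm hn
          (heq.trans hnm.symm)).subExp_mul (subExp_φ_mul_c hh₀ hW ha hD hG hr hm hn)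
      · refine ExpSmall.zero.congr ?_
        filter_upwards [hzero n hn hnm] with h h0
        rw [← h0, zero_mul, zero_mul]
    refine hterms.congr ?_
    filter_upwards [eventually_param hh₀, hexp] with h ⟨hh, hh'⟩ he
    rw [← he]
    simp_rw [mul_sub, Finset.sum_sub_distrib]
    refine sub_eq_self.2 (Eq.trans (Finset.sum_congr rfl fun n _ => ?_)
      (sum_φ_div_c_eq_zero hW hD hm hh hh' hII))
    rw [mul_assoc, c_mul_integral_bump_sq]

include hh₀ hW ha hD hG hr hε hm hm' in
theorem expSmall_gram_of_rank_lt (hrank : L.rank m' < L.rank m) :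
    ExpSmall fun h => ∫ x, quasimode L a D m h x * quasimode L a D m' h x := by
  have hterms : ExpSmall fun h => ∑ n' ∈ hatFinset hW L m',
      D.φ (L.cls m') h m' n' * D.c L a (L.cls m') n' h *
        ∫ x, D.bump L a (L.cls m') n' h x * quasimode L a D m h x := by
    refine ExpSmall.sum fun n' hn' => ?_
    have hn' := (mem_hatFinset hW).1 hn'
    refine ExpSmall.subExp_mul ?_ (subExp_φ_mul_c hh₀ hW ha hD hG hr hm' hn')
    have hsupp : ∀ h x, x ∉ tsupport (D.χ (L.cls m)) → quasimode L a D m h x = 0 := by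
      intro h x hx
      rw [quasimode, if_neg hm.2, image_eq_zero_of_notMem_tsupport hx]
      ring
    by_cases hsub : D.Ω (L.cls m) ⊆ L.T (L.rank m') n'
    · refine (expSmall_integral_quasimode_mul_groundBump hh₀ hW ha hD hG hr hε hm
        hrank (Labeling.hatClass_subset m' hn') hsub).congr
        (.of_forall fun h => ?_)
      refine integral_congr_ae (.of_forall fun x => ?_)
      dsimp only
      by_cases hx : x ∈ tsupport (D.χ (L.cls m))
      · rw [bump_eq, cutoff_eq_one_of_subset hW hD hG hr hε hm hm' hrank hn' hsub hx]
        ring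
      · rw [hsupp h x hx, zero_mul, mul_zero]
    · refine ExpSmall.zero.congr (.of_forall fun h => ?_)
      refine (integral_eq_zero_of_ae (.of_forall fun x => ?_)).symm
      by_cases hx : x ∈ tsupport (D.χ (L.cls m))
      · simp [bump_eq, cutoff_eq_zero_of_not_subset hW hD hG hr hε hm hm' hrank hsub hx]
      · simp [hsupp h x hx]
  refine hterms.congr ?_
  filter_upwards [eventually_param hh₀] with h ⟨hh, hh'⟩
  rw [← integral_quasimode_mul hW ha hD hm' hh hh' (memLp_quasimode hW ha hD hm hh hh')]
  simp_rw [mul_comm]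

include hh₀ hW ha hD hG hr hε hm in
theorem expSmall_gram_ground (hc : m' ∈ critSet W 0) (hm'1 : L.rank m' = 1) :
    ExpSmall fun h => ∫ x, quasimode L a D m h x * quasimode L a D m' h x := by
  have hk := Labeling.two_le_rank hm
  have h1 := expSmall_integral_quasimode_mul_groundBump hh₀ hW ha hD hG hr hε hm
    (by have := hk.1; omega) (hm'1 ▸ Labeling.mem_upTo_rank hc)
    (by rw [Labeling.T_one]; exact subset_univ _)
  refine (h1.subExp_mul (groundBump_normalization hh₀ hW ha m').1).congr (.of_forall fun h => ?_)
  dsimp only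
  rw [← integral_const_mul]
  refine integral_congr_ae (.of_forall fun x => ?_)
  simp only [quasimode, if_pos hm'1]
  ring

include hh₀ hW ha hD hG hr hε hm hm' in
theorem expSmall_gram_of_rank_eq (hrank : L.rank m = L.rank m') :
    ExpSmall fun h => (∫ x, quasimode L a D m h x * quasimode L a D m' h x) -
      kronecker m m' := by
  classical
  have hα := Labeling.cls_mem_classes hm
  have hα' := Labeling.cls_mem_classes hm'
  -- the off-diagonal terms of the double sum over the wells
  have hoff : ExpSmall fun h => ∑ n ∈ hatFinset hW L m, ∑ n' ∈ hatFinset hW L m',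
      if n = n' then 0 else
        (D.φ (L.cls m) h m n * D.c L a (L.cls m) n h) *
          ((D.φ (L.cls m') h m' n' * D.c L a (L.cls m') n' h) *
          ∫ x, D.bump L a (L.cls m) n h x * D.bump L a (L.cls m') n' h x) := by
    refine ExpSmall.sum fun n hn => ExpSmall.sum fun n' hn' => ?_
    have hn := (mem_hatFinset hW).1 hn
    have hn' := (mem_hatFinset hW).1 hn'
    split_ifs with hnn'
    · exact ExpSmall.zero
    · exact ((expSmall_integral_bump_mul_bump hh₀ hW ha hD hG hr hε hm hm' hrank hn hn'
        hnn').subExp_mul (subExp_φ_mul_c hh₀ hW ha hD hG hr hm' hn')).subExp_mul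
        (subExp_φ_mul_c hh₀ hW ha hD hG hr hm hn)
  have hpos : ∀ᶠ h in 𝓝[>] 0, ∀ n ∈ hatFinset hW L m,
      0 < ∫ x, D.bump L a (L.cls m) n h x ^ 2 :=
    (eventually_all_finset _).2 fun n hn =>
      (bump_normalization hW hD hG hr hm hh₀ ha ((mem_hatFinset hW).1 hn)).2
  refine hoff.congr ?_
  filter_upwards [eventually_param hh₀, hpos] with h ⟨hh, hh'⟩ hp
  have hexp : ∫ x, quasimode L a D m h x * quasimode L a D m' h x =
      ∑ n ∈ hatFinset hW L m, ∑ n' ∈ hatFinset hW L m',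
        (D.φ (L.cls m) h m n * D.c L a (L.cls m) n h) *
          ((D.φ (L.cls m') h m' n' * D.c L a (L.cls m') n' h) *
          ∫ x, D.bump L a (L.cls m) n h x * D.bump L a (L.cls m') n' h x) := by
    rw [integral_quasimode_mul hW ha hD hm hh hh' (memLp_quasimode hW ha hD hm' hh hh')]
    refine Finset.sum_congr rfl fun n hn => ?_
    rw [← Finset.mul_sum]
    congr 1
    simp_rw [mul_comm (D.bump L a (L.cls m) n h _)]
    exact integral_quasimode_mul hW ha hD hm' hh hh'
      (memLp_bump hW ha hD hh hh' hα ((mem_hatFinset hW).1 hn))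
  have hdiag : ∑ n ∈ hatFinset hW L m, ∑ n' ∈ hatFinset hW L m',
      (if n = n' then
        (D.φ (L.cls m) h m n * D.c L a (L.cls m) n h) *
          ((D.φ (L.cls m') h m' n' * D.c L a (L.cls m') n' h) *
          ∫ x, D.bump L a (L.cls m) n h x * D.bump L a (L.cls m') n' h x) else 0) =
      kronecker m m' := by
    simp_rw [Finset.sum_ite_eq]
    by_cases hcls : L.cls m = L.cls m'
    · have hm'cls : m' ∈ L.hatClass (L.cls m) := hcls ▸ Labeling.mem_hatClass hm'
      have hfs : hatFinset hW L m' = hatFinset hW L m := by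
        ext n
        rw [mem_hatFinset, mem_hatFinset, hcls]
      rw [hfs, ← hcls]
      have hsum : ∑ n ∈ hatFinset hW L m, D.φ (L.cls m) h m n * D.φ (L.cls m) h m' n =
          kronecker m m' := by
        rw [← finsum_hatClass hW, kronecker]
        split_ifs with heq
        · subst heq
          exact hD.φ_norm _ hα h hh hh' m (Labeling.mem_hatClass hm)
        · exact hD.φ_orth _ hα h hh hh' m (Labeling.mem_hatClass hm) m' hm'cls heq
      rw [← hsum]
      refine Finset.sum_congr rfl fun n hn => ?_
      rw [if_pos hn]
      have hc := c_mul_integral_bump_sq (L := L) (a := a) (D := D) (n := n) (α := L.cls m) (h := h)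
      have hc0 : D.c L a (L.cls m) n h ≠ 0 := inv_ne_zero (Real.sqrt_pos.2 (hp n hn)).ne'
      simp_rw [← sq]
      rw [mul_assoc (D.φ (L.cls m) h m' n), hc]
      field_simp
    · have hmm' : m ≠ m' := fun h => hcls (h ▸ rfl)
      rw [kronecker, if_neg hmm']
      refine Finset.sum_eq_zero fun n hn => ?_
      split_ifs with hn'
      · have h0 := φ_mul_φ_eq_zero hW hD hm hh hh' hm' hrank hcls ((mem_hatFinset hW).1 hn)
          ((mem_hatFinset hW).1 hn')
        rcases mul_eq_zero.1 h0 with h0 | h0 <;> simp [h0]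
      · rfl
  rw [hexp, ← hdiag, ← Finset.sum_sub_distrib]
  refine Finset.sum_congr rfl fun n _ => ?_
  rw [← Finset.sum_sub_distrib]
  refine Finset.sum_congr rfl fun n' _ => ?_
  split_ifs <;> simp

end Gram

section Main

variable (hh₀ : 0 < h₀) (hW : IsPotential W h₀) (ha : IsAmplitude W h₀ a)
  (hD : IsAdmissible L h₀ a D) (hG : IsGap L κ δ) (hr : D.r < δ) (hε : D.ε < δ)
  {m m' : Space d} (hm : m ∈ critSet W 0) (hm' : m' ∈ critSet W 0)

include hh₀ hW ha in
theorem expSmall_gram_ground_self (hm1 : L.rank m = 1) :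
    ExpSmall fun h => (∫ x, quasimode L a D m h x * quasimode L a D m h x) - 1 := by
  refine ExpSmall.zero.congr ?_
  filter_upwards [(groundBump_normalization hh₀ hW ha m).2] with h hpos
  simp only [quasimode, if_pos hm1]
  simp_rw [← sq, mul_pow]
  rw [integral_const_mul, inv_pow, Real.sq_sqrt hpos.le, inv_mul_cancel₀ hpos.ne', sub_self]

include hh₀ hW ha hD hG hr hε hm hm' in
theorem expSmall_gram :
    ExpSmall fun h => (∫ x, quasimode L a D m h x * quasimode L a D m' h x) -
      kronecker m m' := by
  have hoff : ∀ {p q : Space d}, p ∈ critSet W 0 → q ∈ critSet W 0 → L.rank q < L.rank p →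
      ExpSmall fun h => ∫ x, quasimode L a D p h x * quasimode L a D q h x := by
    intro p q hp hq hlt
    have hq1 := (Labeling.rank_mem (L := L) hq).1
    have hpe : p ∈ L.excited := ⟨hp, by omega⟩
    by_cases h1 : L.rank q = 1
    · exact expSmall_gram_ground hh₀ hW ha hD hG hr hε hpe hq h1
    · exact expSmall_gram_of_rank_lt hh₀ hW ha hD hG hr hε hpe ⟨hq, h1⟩ hlt
  rcases lt_trichotomy (L.rank m') (L.rank m) with hlt | heq | hlt
  · rw [kronecker, if_neg (by rintro rfl; exact lt_irrefl _ hlt)]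
    simpa only [sub_zero] using hoff hm hm' hlt
  · by_cases h1 : L.rank m = 1
    · obtain rfl := Labeling.eq_of_rank_one hm hm' h1 (heq.trans h1)
      rw [kronecker, if_pos rfl]
      exact expSmall_gram_ground_self hh₀ hW ha h1
    · exact expSmall_gram_of_rank_eq hh₀ hW ha hD hG hr hε ⟨hm, h1⟩ ⟨hm', heq ▸ h1⟩ heq.symm
  · rw [kronecker, if_neg (by rintro rfl; exact lt_irrefl _ hlt)]
    simp_rw [mul_comm (quasimode L a D m _ _), sub_zero]
    exact hoff hm' hm hlt

end Main

end Quasimode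

theorem proposition4 {d : ℕ} (W : Space d → ℝ) (h₀ : ℝ) (hh₀ : 0 < h₀)
    (hW : IsPotential W h₀) (L : Labeling W)
    (a : ℝ → Space d → ℝ) (ha : IsAmplitude W h₀ a) :
    ∃ δ > 0, ∀ D : Choices d, IsAdmissible L h₀ a D → D.r < δ → D.ε < δ →
      ∃ c > 0, ∃ C : ℝ, ∃ h₁ ∈ Set.Ioc 0 h₀, ∀ h, 0 < h → h ≤ h₁ →
        (∀ m ∈ critSet W 0,
          MeasureTheory.MemLp (quasimode L a D m h) 2 MeasureTheory.volume) ∧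
        ∀ m ∈ critSet W 0, ∀ m' ∈ critSet W 0,
          |(∫ x, quasimode L a D m h x * quasimode L a D m' h x) - kronecker m m'| ≤
            C * Real.exp (-c / h) := by
  obtain ⟨κ, δ, hG⟩ := exists_isGap hW L
  refine ⟨δ, hG.δ_pos, fun D hD hr hε => ?_⟩
  have hfin : (critSet W 0).Finite := hW.finite_crit 0 (Nat.zero_le _)
  obtain ⟨c, hc, C, hev⟩ := exists_uniform_bound (hfin.prod hfin)
    (F := fun p h => (∫ x, quasimode L a D p.1 h x * quasimode L a D p.2 h x) -
      kronecker p.1 p.2)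
    fun p hp => expSmall_gram hh₀ hW ha hD hG hr hε hp.1 hp.2
  obtain ⟨h₁, hh₁, hsub⟩ := mem_nhdsGT_iff_exists_Ioc_subset.1 hev
  refine ⟨c, hc, C, min h₁ h₀, ⟨lt_min hh₁ hh₀, min_le_right _ _⟩, fun h hh hle => ⟨?_, ?_⟩⟩
  · intro m hm
    have hh' : h ≤ h₀ := hle.trans (min_le_right _ _)
    by_cases h1 : L.rank m = 1
    · have : quasimode L a D m h = fun x =>
          (Real.sqrt (∫ y, groundBump W a m h y ^ 2))⁻¹ * groundBump W a m h x := by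
        funext x
        rw [quasimode, if_pos h1]
      rw [this]
      exact (memLp_groundBump hW ha hh hh' m).const_mul _
    · exact memLp_quasimode hW ha hD ⟨hm, h1⟩ hh hh'
  · intro m hm m' hm'
    exact hsub ⟨hh, hle.trans (min_le_left _ _)⟩ (m, m') ⟨hm, hm'⟩
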